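/- Let $1<\alpha<2$, $\omega>0$, let $E_\alpha(z)=\sum_{k\ge 0} z^k/\Gamma(\alpha k+1)$ be the Mittag-Leffler function, and let $i^\alpha=e^{i\pi\alpha/2}$. For a function $u$ on $[0,\infty)$ with values in a Hilbert space and with continuous derivative, let $$(\mathbb D^{(\alpha)}u)(t)=\frac1{\Gamma(2-\alpha)}\frac{d}{dt}\int_0^t(t-\tau)^{1-\alpha}u'(\tau)\,d\tau-\frac{t^{1-\alpha}}{\Gamma(2-\alpha)}u'(0),\qquad t>0,$$ be its Caputo-Dzhrbashyan fractional derivative. Let $A\ge 0$ be a (possibly unbounded) nonnegative selfadjoint operator on a complex Hilbert space $\mathcal H$ such that $0$ is not an eigenvalue of $A$, and let $f_0\in D(A^{-1})$, that is, $f_0$ lies in the range of $A$. Let $u$ be a strong solution of $$\mathbb D^{(\alpha)}u(t)+Au(t)=E_\alpha(i^\alpha\omega^\alpha t^\alpha)f_0\quad (t>0),\qquad u(0)=u'(0)=0,$$ that is, $u\in C^1([0,\infty),\mathcal H)$, $u(t)\in D(A)$ for all $t\ge 0$, the function $t\mapsto\int_0^t(t-\tau)^{1-\alpha}u'(\tau)\,d\tau$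 is continuously differentiable for $t>0$, and the above equalities hold. Then $E_\alpha(i^\alpha\omega^\alpha t^\alpha)\ne 0$ for all sufficiently large $t$, the operator $A+i^\alpha\omega^\alpha I$ has a bounded inverse defined on all of $\mathcal H$, and $$\frac{u(t)}{E_\alpha(i^\alpha\omega^\alpha t^\alpha)}\longrightarrow (A+i^\alpha\omega^\alpha I)^{-1}f_0\qquad\text{as } t\to\infty,$$ in the norm of $\mathcal H$. -/

import Mathlib

open Filter Topology

noncomputable section

/-- The Mittag-Leffler function `E_α(z) = ∑_{k ≥ 0} z ^ k / Γ(α k + 1)`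
(an everywhere convergent power series when `α > 0`). -/
def mittagLeffler (α : ℝ) (z : ℂ) : ℂ :=
  ∑' k : ℕ, z ^ k / (Real.Gamma (α * k + 1) : ℂ)

/-- The number `i ^ α ω ^ α`, with the principal value `i ^ α = exp (i π α / 2)`. -/
def iOmegaPow (α ω : ℝ) : ℂ :=
  Complex.I ^ (α : ℂ) * ((ω ^ α : ℝ) : ℂ)

/-- The oscillation `t ↦ E_α(i ^ α ω ^ α t ^ α)`. -/
def mlOscillation (α ω t : ℝ) : ℂ :=
  mittagLeffler α (iOmegaPow α ω * ((t ^ α : ℝ) : ℂ))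

section Caputo

variable {H : Type*} [NormedAddCommGroup H] [NormedSpace ℝ H]

/-- The derivative `u'` of a function on the half-line `[0, ∞)` (one-sided at `0`). -/
def halfLineDeriv (u : ℝ → H) (t : ℝ) : H :=
  derivWithin u (Set.Ici 0) t

/-- The function `t ↦ ∫₀ᵗ (t - τ) ^ (1 - α) u'(τ) dτ`. -/
def caputoIntegral (α : ℝ) (u : ℝ → H) (t : ℝ) : H :=
  ∫ τ in (0 : ℝ)..t, (t - τ) ^ (1 - α) • halfLineDeriv u τ

/-- The Caputo-Dzhrbashyan fractional derivative of order `α ∈ (1, 2)` at a point `t > 0`: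
`Γ(2 - α)⁻¹ (d/dt ∫₀ᵗ (t - τ) ^ (1 - α) u'(τ) dτ - t ^ (1 - α) u'(0))`. -/
def caputoDeriv (α : ℝ) (u : ℝ → H) (t : ℝ) : H :=
  (Real.Gamma (2 - α))⁻¹ • deriv (caputoIntegral α u) t
    - (t ^ (1 - α) / Real.Gamma (2 - α)) • halfLineDeriv u 0

end Caputo

variable {H : Type*} [NormedAddCommGroup H] [InnerProductSpace ℂ H]

/-- `u` is a strong solution of `D^{(α)} u + A u = f`, `u(0) = u'(0) = 0`, on the half-line. -/
structure IsStrongSolution (A : H →ₗ.[ℂ] H) (α : ℝ) (f u : ℝ → H) : Prop where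
  contDiffOn : ContDiffOn ℝ 1 u (Set.Ici 0)
  mem_domain : ∀ t : ℝ, 0 ≤ t → u t ∈ A.domain
  contDiffOn_caputoIntegral : ContDiffOn ℝ 1 (caputoIntegral α u) (Set.Ioi 0)
  equation : ∀ (t : ℝ) (ht : 0 < t), caputoDeriv α u t + A ⟨u t, mem_domain t ht.le⟩ = f t
  initial : u 0 = 0
  initial_deriv : halfLineDeriv u 0 = 0

/-- The bounded everywhere defined operator `R` is the inverse `(A + c I)⁻¹` of
`A + c I : D(A) → H`. -/
structure IsShiftInverse (A : H →ₗ.[ℂ] H) (c : ℂ) (R : H →L[ℂ] H) : Prop where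
  mem_domain : ∀ y : H, R y ∈ A.domain
  right_inv : ∀ y : H, A ⟨R y, mem_domain y⟩ + c • R y = y
  left_inv : ∀ x : A.domain, R (A x + c • (x : H)) = x

end

open MeasureTheory Set

/-! ### Power series in `t ^ α` with Mittag-Leffler weights -/

section Series

/-! Write c = i^α ω^α, E(t) = E_α(c t^α), r = (A + c)⁻¹ f₀. As E satisfies D^α E = c E with E(0) =
1, the difference w = E r - u solves the homogeneous equation with w(0) = r, w'(0) = 0, so formally
w(t) = E_α(-t^α A) r. Two scalar facts decide: E(t) - exp(iωt)/α → 0, so |E| is eventually at least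
1/(2α); and E_α(-x) → 0 as x → +∞, so E_α(-t^α λ) → 0 for each λ > 0. The latter is not uniform near
λ = 0. Here f₀ = A g enters: r = A(A + 1)⁻¹ y for some y, and the factor λ/(1 + λ) ≤ min(1, λ)
restores uniformity (`exists_forall_realMittagLeffler_mul_min_le`). Hence w → 0 in norm, and
dividing by E gives the limit.

The formula for w is made rigorous by bounded operators only. Let T = (A + 1)⁻¹. The operator P = 1
- ε max(T, ε)⁻¹ kills the spectral part T ≤ ε, where A is large, and P A = B P on D(A) with B =
max(T, ε)⁻¹ - 1 bounded (`cutoff_mul_one_sub`). Inverting the Caputo derivative by the semigroup law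
of fractional integrals J (`IsStrongSolution.volterra`) gives P w = P r - J^α(B P w), whose unique
continuous solution is the series E_α(-t^α B) P r (`IsStrongSolution.compression_eq`). The resulting
bound does not depend on ε, and w(t) ∈ D(A) allows ε → 0 at fixed t
(`IsStrongSolution.tendsto_sub`).

The scalar asymptotics come from the Laplace transform s^(α-1)/(s^α - c). For 1 < α < 2 it has no
pole in the closed right half-plane when c = -1, and only s = i, with residue 1/α, when c = i^α.
With the pole removed, the contour moves to the imaginary axis and the Riemann-Lebesgue lemma
applies (`tendsto_zero_of_laplace`). -/

theorem factorial_le_Gamma_mul_add_one {α : ℝ} (hα : 1 ≤ α) (k : ℕ) :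
    (k.factorial : ℝ) ≤ Real.Gamma (α * k + 1) := by
  rcases Nat.eq_zero_or_pos k with rfl | hk
  · simp
  rw [← Real.Gamma_nat_eq_factorial]
  have hk' : (1 : ℝ) ≤ k := by exact_mod_cast hk
  have h : (k : ℝ) ≤ α * k := by nlinarith
  exact Real.Gamma_strictMonoOn_Ici.monotoneOn (by simp; linarith) (by simp; linarith) (by linarith)

theorem Gamma_mul_add_one_pos {α : ℝ} (hα : 1 ≤ α) (k : ℕ) : 0 < Real.Gamma (α * k + 1) :=
  Real.Gamma_pos_of_pos (by positivity)

theorem summable_pow_div_Gamma {α : ℝ} (hα : 1 ≤ α) (x : ℝ) :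
    Summable fun k : ℕ => |x| ^ k / Real.Gamma (α * k + 1) := by
  refine Summable.of_nonneg_of_le (fun k => ?_) (fun k => ?_) (Real.summable_pow_div_factorial |x|)
  · have := Gamma_mul_add_one_pos hα k
    positivity
  · gcongr
    exact factorial_le_Gamma_mul_add_one hα k

variable {E : Type*} [NormedAddCommGroup E] [NormedSpace ℝ E]

/-- The series `∑ t ^ (α k) / Γ(α k + 1) • v k`. -/
noncomputable def fracSeries (α : ℝ) (v : ℕ → E) (t : ℝ) : E :=
  ∑' k : ℕ, ((t ^ α) ^ k / Real.Gamma (α * k + 1)) • v k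

/-- The Riemann-Liouville fractional integral of order `a` based at `0`. -/
noncomputable def rlIntegral (a : ℝ) (g : ℝ → E) (t : ℝ) : E :=
  (Real.Gamma a)⁻¹ • ∫ s in (0 : ℝ)..t, (t - s) ^ (a - 1) • g s

theorem norm_fracSeries_term_le {α : ℝ} (hα : 1 ≤ α) {v : ℕ → E} {C ρ : ℝ}
    (hv : ∀ k, ‖v k‖ ≤ C * ρ ^ k) {t N : ℝ} (ht : 0 ≤ t) (htN : t ≤ N) (k : ℕ) :
    ‖((t ^ α) ^ k / Real.Gamma (α * k + 1)) • v k‖ ≤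
      C * (|N ^ α * ρ| ^ k / Real.Gamma (α * k + 1)) := by
  have hΓ := Gamma_mul_add_one_pos hα k
  have htα : 0 ≤ t ^ α := Real.rpow_nonneg ht _
  have hNα : t ^ α ≤ N ^ α := Real.rpow_le_rpow ht htN (by linarith)
  have hN0 : 0 ≤ N ^ α := htα.trans hNα
  have hC : 0 ≤ C := by simpa using (norm_nonneg _).trans (hv 0)
  have hv' : ‖v k‖ ≤ C * |ρ| ^ k := (hv k).trans (by
    rw [← abs_pow]; exact mul_le_mul_of_nonneg_left (le_abs_self _) hC)
  rw [norm_smul, Real.norm_of_nonneg (by positivity), abs_mul, abs_of_nonneg (htα.trans hNα)]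
  calc (t ^ α) ^ k / Real.Gamma (α * k + 1) * ‖v k‖
      ≤ (N ^ α) ^ k / Real.Gamma (α * k + 1) * (C * |ρ| ^ k) := by gcongr
    _ = _ := by rw [mul_pow]; ring

theorem summable_fracSeries_bound {α : ℝ} (hα : 1 ≤ α) (C ρ N : ℝ) :
    Summable fun k : ℕ => C * (|N ^ α * ρ| ^ k / Real.Gamma (α * k + 1)) :=
  (summable_pow_div_Gamma hα _).mul_left C

theorem summable_fracSeries [CompleteSpace E] {α : ℝ} (hα : 1 ≤ α) {v : ℕ → E} {C ρ : ℝ}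
    (hv : ∀ k, ‖v k‖ ≤ C * ρ ^ k) {t : ℝ} (ht : 0 ≤ t) :
    Summable fun k : ℕ => ((t ^ α) ^ k / Real.Gamma (α * k + 1)) • v k :=
  .of_norm_bounded (summable_fracSeries_bound hα C ρ t)
    (norm_fracSeries_term_le hα hv ht le_rfl)

theorem continuousOn_fracSeries [CompleteSpace E] {α : ℝ} (hα : 1 ≤ α) {v : ℕ → E} {C ρ : ℝ}
    (hv : ∀ k, ‖v k‖ ≤ C * ρ ^ k) : ContinuousOn (fracSeries α v) (Ici 0) := by
  have hα0 : 0 ≤ α := by linarith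
  intro t ht
  have h : ContinuousOn (fracSeries α v) (Icc 0 (t + 1)) := by
    refine continuousOn_tsum (fun k => ?_) (summable_fracSeries_bound hα C ρ (t + 1))
      (fun k s hs => norm_fracSeries_term_le hα hv hs.1 hs.2 k)
    exact ((((Real.continuous_rpow_const hα0).pow k).div_const _).smul
      continuous_const).continuousOn
  refine (h t ⟨ht, by linarith⟩).mono_of_mem_nhdsWithin ?_
  rw [← Ici_inter_Iic]
  exact inter_mem self_mem_nhdsWithin (mem_nhdsWithin_of_mem_nhds (Iic_mem_nhds (by linarith)))

theorem fracSeries_zero {α : ℝ} (hα : α ≠ 0) (v : ℕ → E) : fracSeries α v 0 = v 0 := by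
  rw [fracSeries, tsum_eq_single 0]
  · simp
  · intro k hk
    simp [Real.zero_rpow hα, hk]

end Series

/-! ### Real Beta integrals -/

section Beta

theorem integral_sub_rpow_mul_rpow {a b t : ℝ} (ha : 0 < a) (hb : 0 < b) (ht : 0 < t) :
    ∫ s in (0 : ℝ)..t, (t - s) ^ (a - 1) * s ^ (b - 1) =
      t ^ (a + b - 1) * (Real.Gamma a * Real.Gamma b / Real.Gamma (a + b)) := by
  have h := Complex.betaIntegral_scaled b a ht
  have hB := Complex.Gamma_mul_Gamma_eq_betaIntegral (s := (b : ℂ)) (t := (a : ℂ))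
    (by simpa) (by simpa)
  have hΓ : Complex.Gamma ((b : ℂ) + a) ≠ 0 := by
    rw [← Complex.ofReal_add, Complex.Gamma_ofReal]
    exact_mod_cast (Real.Gamma_pos_of_pos (by linarith)).ne'
  have hB' : Complex.betaIntegral b a =
      Complex.Gamma b * Complex.Gamma a / Complex.Gamma (b + a) := by
    rw [hB]; field_simp
  have h1 : ∫ x in (0 : ℝ)..t, (x : ℂ) ^ ((b : ℂ) - 1) * ((t : ℂ) - x) ^ ((a : ℂ) - 1) =
      ((∫ s in (0 : ℝ)..t, (t - s) ^ (a - 1) * s ^ (b - 1) : ℝ) : ℂ) := by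
    rw [← intervalIntegral.integral_ofReal]
    refine intervalIntegral.integral_congr (fun x hx => ?_)
    rw [uIcc_of_le ht.le] at hx
    push_cast [Complex.ofReal_cpow hx.1, Complex.ofReal_cpow (sub_nonneg.2 hx.2)]
    ring
  rw [h1, hB', ← Complex.ofReal_add, Complex.Gamma_ofReal, Complex.Gamma_ofReal,
    Complex.Gamma_ofReal] at h
  have h2 : (t : ℂ) ^ ((b + a : ℝ) - 1 : ℂ) = ((t ^ (a + b - 1) : ℝ) : ℂ) := by
    rw [Complex.ofReal_cpow ht.le]; push_cast; ring_nf
  rw [h2] at h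
  have := congrArg Complex.re h
  rw [← Complex.ofReal_mul, ← Complex.ofReal_div, ← Complex.ofReal_mul, Complex.ofReal_re,
    Complex.ofReal_re] at this
  rw [this]
  ring_nf

theorem intervalIntegrable_sub_rpow {a : ℝ} (ha : 0 < a) (t c d : ℝ) :
    IntervalIntegrable (fun s => (t - s) ^ (a - 1)) volume c d := by
  have h := (intervalIntegral.intervalIntegrable_rpow' (a := t - c) (b := t - d)
    (r := a - 1) (by linarith)).comp_sub_left t
  simpa using h

theorem integral_sub_rpow {a : ℝ} (ha : 0 < a) (t : ℝ) :
    ∫ s in (0 : ℝ)..t, (t - s) ^ (a - 1) = t ^ a / a := by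
  have := intervalIntegral.integral_comp_sub_left (fun x : ℝ => x ^ (a - 1)) t (a := 0) (b := t)
  rw [this, integral_rpow (Or.inl (by linarith))]
  simp [Real.zero_rpow ha.ne']

theorem integral_sub_rpow_mul_sub_rpow {a b τ t : ℝ} (ha : 0 < a) (hb : 0 < b) (ht : τ < t) :
    ∫ s in τ..t, (t - s) ^ (a - 1) * (s - τ) ^ (b - 1) =
      (t - τ) ^ (a + b - 1) * (Real.Gamma a * Real.Gamma b / Real.Gamma (a + b)) := by
  rw [← integral_sub_rpow_mul_rpow ha hb (sub_pos.2 ht)]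
  have := intervalIntegral.integral_comp_sub_right
    (fun x : ℝ => (t - τ - x) ^ (a - 1) * x ^ (b - 1)) τ (a := τ) (b := t)
  simpa using this

end Beta

/-! ### Volterra equations of order α -/

section Volterra

variable {E : Type*} [NormedAddCommGroup E] [NormedSpace ℝ E]

theorem rlIntegral_add {a : ℝ} (ha : 0 < a) {f g : ℝ → E} {t : ℝ} (ht : 0 ≤ t)
    (hf : ContinuousOn f (Icc 0 t)) (hg : ContinuousOn g (Icc 0 t)) :
    rlIntegral a (fun s => f s + g s) t = rlIntegral a f t + rlIntegral a g t := by
  have h : ∀ f : ℝ → E, ContinuousOn f (Icc 0 t) →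
      IntervalIntegrable (fun s => (t - s) ^ (a - 1) • f s) volume 0 t := fun f hf =>
    (intervalIntegrable_sub_rpow ha t 0 t).smul_continuousOn (by rwa [uIcc_of_le ht])
  simp only [rlIntegral, smul_add]
  rw [intervalIntegral.integral_add (h f hf) (h g hg), smul_add]

/-- Uniqueness for the Volterra equation `z = -J^α (B z)`. -/
theorem eq_zero_of_eq_rlIntegral {α : ℝ} (hα : 1 < α) (L : E →L[ℝ] E) {z : ℝ → E}
    (hz : ContinuousOn z (Ici 0)) (h : ∀ t, 0 ≤ t → z t = rlIntegral α (fun s => L (z s)) t)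
    {t : ℝ} (ht : 0 ≤ t) : z t = 0 := by
  set K : ℝ := |(Real.Gamma α)⁻¹| * (t ^ (α - 1) * ‖L‖) with hK
  have hzt : ContinuousOn (fun s => ‖z s‖) (Icc 0 t) := (hz.mono Icc_subset_Ici_self).norm
  -- Since α > 1 the kernel is not singular: (x - s)^(α-1) ≤ t^(α-1), so the ordinary Gronwall
  -- inequality suffices.
  have key : ∀ x ∈ Icc (0 : ℝ) t, ‖z x‖ ≤ K * ∫ s in (0 : ℝ)..x, ‖z s‖ := by
    intro x hx
    rw [h x hx.1, rlIntegral, norm_smul, hK, Real.norm_eq_abs, mul_assoc]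
    gcongr
    rw [← intervalIntegral.integral_const_mul]
    refine intervalIntegral.norm_integral_le_of_norm_le hx.1
      (Eventually.of_forall fun s hs => ?_) ?_
    · rw [norm_smul, mul_assoc, Real.norm_of_nonneg (Real.rpow_nonneg (by linarith [hs.2]) _)]
      have := L.le_opNorm (z s)
      have h2 := Real.rpow_le_rpow (z := α - 1) (show 0 ≤ x - s by linarith [hs.2])
        (show x - s ≤ t by linarith [hs.1, hx.2]) (by linarith)
      have h3 := Real.rpow_nonneg ht (α - 1)
      gcongr
    · refine ContinuousOn.intervalIntegrable ?_
      rw [uIcc_of_le hx.1]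
      exact continuousOn_const.mul (hzt.mono (Icc_subset_Icc_right hx.2))
  -- Gronwall for the primitive G of ‖z‖: G(0) = 0 and G' = ‖z‖ ≤ K G force G = 0.
  have hG : ∀ x ∈ Icc (0 : ℝ) t, ‖∫ s in (0 : ℝ)..x, ‖z s‖‖ ≤ gronwallBound 0 K 0 (x - 0) := by
    refine norm_le_gronwallBound_of_norm_deriv_right_le (f' := fun x => ‖z x‖) ?_ ?_ (by simp) ?_
    · rw [← uIcc_of_le ht]
      exact intervalIntegral.continuousOn_primitive_interval (by
        rw [uIcc_of_le ht]; exact hzt.integrableOn_Icc (μ := volume))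
    · intro x hx
      have hx' : ContinuousOn (fun s => ‖z s‖) (uIcc 0 x) := by
        rw [uIcc_of_le hx.1]; exact hzt.mono (Icc_subset_Icc_right hx.2.le)
      have hc : ContinuousWithinAt (fun s => ‖z s‖) (Ici x) x :=
        ((hz x hx.1).mono (Ici_subset_Ici.2 hx.1)).norm
      refine intervalIntegral.integral_hasDerivWithinAt_right hx'.intervalIntegrable ?_
        (t := Ioi x) (hc.mono Ioi_subset_Ici_self)
      refine ⟨Icc x t, Icc_mem_nhdsGT hx.2, ?_⟩
      exact (hzt.mono (Icc_subset_Icc_left hx.1)).aestronglyMeasurable measurableSet_Icc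
    · intro x hx
      rw [norm_norm, add_zero]
      refine (key x ⟨hx.1, hx.2.le⟩).trans ?_
      have : 0 ≤ K := by have := Real.rpow_nonneg ht (α - 1); positivity
      gcongr
      exact le_abs_self _
  have h0 := hG t ⟨ht, le_rfl⟩
  rw [gronwallBound_ε0_δ0] at h0
  have h1 := key t ⟨ht, le_rfl⟩
  rw [norm_le_zero_iff.1 h0, mul_zero] at h1
  exact norm_le_zero_iff.1 h1

variable [CompleteSpace E]

theorem rlIntegral_rpow_smul {a b t : ℝ} (ha : 0 < a) (hb : 0 ≤ b) (ht : 0 < t) (v : E) :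
    rlIntegral a (fun s => s ^ b • v) t =
      (t ^ (b + a) * (Real.Gamma (b + 1) / Real.Gamma (b + a + 1))) • v := by
  have h := integral_sub_rpow_mul_rpow ha (show 0 < b + 1 by linarith) ht
  simp only [add_sub_cancel_right] at h
  simp only [rlIntegral, smul_smul]
  rw [intervalIntegral.integral_smul_const, h, smul_smul]
  congr 1
  have : Real.Gamma a ≠ 0 := (Real.Gamma_pos_of_pos ha).ne'
  rw [show a + (b + 1) - 1 = b + a by ring, show a + (b + 1) = b + a + 1 by ring]
  field_simp

/-- The fractional series solves a Volterra equation. -/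
theorem fracSeries_eq_add_rlIntegral {α : ℝ} (hα : 1 < α) {v : ℕ → E} {C ρ : ℝ}
    (hv : ∀ k, ‖v k‖ ≤ C * ρ ^ k) {t : ℝ} (ht : 0 ≤ t) :
    fracSeries α v t = v 0 + rlIntegral α (fracSeries α fun k => v (k + 1)) t := by
  rcases ht.eq_or_lt with rfl | ht0
  · simp [fracSeries_zero (by linarith : α ≠ 0), rlIntegral]
  have hv' : ∀ k, ‖v (k + 1)‖ ≤ (C * ρ) * ρ ^ k := fun k => (hv (k + 1)).trans_eq (by ring)
  rw [fracSeries, (summable_fracSeries hα.le hv ht).tsum_eq_zero_add]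
  simp only [pow_zero, Nat.cast_zero, mul_zero, zero_add, Real.Gamma_one, div_one, one_smul]
  congr 1
  -- Termwise integration, dominated on [0, t]; each term is then a Beta integral that raises the
  -- index k by one.
  have hsum : HasSum (fun k : ℕ => ∫ s in (0 : ℝ)..t,
      (t - s) ^ (α - 1) • ((s ^ α) ^ k / Real.Gamma (α * k + 1)) • v (k + 1))
      (∫ s in (0 : ℝ)..t, (t - s) ^ (α - 1) • fracSeries α (fun k => v (k + 1)) s) := by
    refine intervalIntegral.hasSum_integral_of_dominated_convergence
      (fun k _ => t ^ (α - 1) * ((C * ρ) * (|t ^ α * ρ| ^ k / Real.Gamma (α * k + 1))))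
      (fun k => ?_) (fun k => ?_) ?_ ?_ ?_
    · refine Continuous.aestronglyMeasurable ?_
      have h1 := Real.continuous_rpow_const (q := α - 1) (by linarith)
      have h2 := Real.continuous_rpow_const (q := α) (by linarith)
      exact (h1.comp (continuous_const.sub continuous_id)).smul
        (((h2.pow k).div_const _).smul continuous_const)
    · refine Eventually.of_forall fun s hs => ?_
      rw [uIoc_of_le ht] at hs
      rw [norm_smul]
      refine mul_le_mul ?_ (norm_fracSeries_term_le hα.le hv' hs.1.le hs.2 k) (norm_nonneg _)
        (by positivity)
      rw [Real.norm_of_nonneg (Real.rpow_nonneg (by linarith [hs.2]) _)]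
      exact Real.rpow_le_rpow (by linarith [hs.2]) (by linarith [hs.1]) (by linarith)
    · exact Eventually.of_forall fun s _ => (summable_fracSeries_bound hα.le _ _ _).mul_left _
    · exact intervalIntegrable_const
    · refine Eventually.of_forall fun s hs => ?_
      rw [uIoc_of_le ht] at hs
      exact (summable_fracSeries hα.le hv' hs.1.le).hasSum.const_smul _
  rw [rlIntegral, ← (hsum.const_smul _).tsum_eq]
  congr 1
  ext k
  have h := rlIntegral_rpow_smul (a := α) (b := α * k) (by linarith) (by positivity) ht0 (v (k + 1))
  have hΓ := (Gamma_mul_add_one_pos hα.le k).ne'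
  have h2 : ∫ s in (0 : ℝ)..t,
      (t - s) ^ (α - 1) • ((s ^ α) ^ k / Real.Gamma (α * k + 1)) • v (k + 1) =
      (Real.Gamma (α * k + 1))⁻¹ • ∫ s in (0 : ℝ)..t, (t - s) ^ (α - 1) • s ^ (α * k) • v (k + 1) := by
    rw [← intervalIntegral.integral_smul]
    refine intervalIntegral.integral_congr fun s hs => ?_
    rw [uIcc_of_le ht] at hs
    simp only [smul_smul, Real.rpow_mul_natCast hs.1]
    congr 1
    ring
  rw [h2, smul_comm, ← rlIntegral, h, smul_smul]
  congr 1
  rw [show α * ((k + 1 : ℕ) : ℝ) + 1 = α * k + α + 1 by push_cast; ring,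
    ← Real.rpow_mul_natCast ht]
  push_cast
  rw [mul_add, mul_one]
  field_simp

theorem ContinuousLinearMap.rlIntegral_comp {F : Type*} [NormedAddCommGroup F] [NormedSpace ℝ F]
    [CompleteSpace F] (L : E →L[ℝ] F) {a : ℝ} (ha : 0 < a) {f : ℝ → E} {t : ℝ} (ht : 0 ≤ t)
    (hf : ContinuousOn f (Icc 0 t)) :
    rlIntegral a (fun s => L (f s)) t = L (rlIntegral a f t) := by
  have h : IntervalIntegrable (fun s => (t - s) ^ (a - 1) • f s) volume 0 t :=
    (intervalIntegrable_sub_rpow ha t 0 t).smul_continuousOn (by rwa [uIcc_of_le ht])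
  simp only [rlIntegral, map_smul]
  rw [← L.intervalIntegral_comp_comm h]
  simp

end Volterra

/-! ### Semigroup law of fractional integrals -/

section Semigroup

/-- The locally integrable kernel `x ↦ x₊ ^ (b - 1)`. -/
noncomputable def rlKernel (b : ℝ) : ℝ → ℝ := (Ioi (0 : ℝ)).indicator fun x => x ^ (b - 1)

theorem measurable_rlKernel (b : ℝ) : Measurable (rlKernel b) :=
  (measurable_id.pow_const _).indicator measurableSet_Ioi

theorem rlKernel_nonneg (b x : ℝ) : 0 ≤ rlKernel b x :=
  indicator_nonneg (fun _ hx => Real.rpow_nonneg (le_of_lt hx) _) x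

theorem rlKernel_of_pos {b x : ℝ} (hx : 0 < x) : rlKernel b x = x ^ (b - 1) :=
  indicator_of_mem (show x ∈ Ioi 0 from hx) _

variable {E : Type*} [NormedAddCommGroup E] [NormedSpace ℝ E]

theorem setIntegral_rlKernel_sub_left (b : ℝ) (h : ℝ → E) {s t : ℝ} (hs : 0 ≤ s) (hst : s ≤ t) :
    ∫ τ in Ioc 0 t, rlKernel b (s - τ) • h τ = ∫ τ in (0 : ℝ)..s, (s - τ) ^ (b - 1) • h τ := by
  have h1 : (fun τ => rlKernel b (s - τ) • h τ) =
      (Iio s).indicator fun τ => (s - τ) ^ (b - 1) • h τ := by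
    ext τ
    by_cases hτ : τ < s
    · rw [indicator_of_mem (show τ ∈ Iio s from hτ), rlKernel_of_pos (sub_pos.2 hτ)]
    · rw [indicator_of_notMem (show τ ∉ Iio s from hτ), rlKernel,
        indicator_of_notMem (by simpa using hτ), zero_smul]
  have h2 : Ioc 0 t ∩ Iio s = Ioo 0 s := by
    ext x
    simp only [mem_inter_iff, mem_Ioc, mem_Iio, mem_Ioo]
    exact ⟨fun h => ⟨h.1.1, h.2⟩, fun h => ⟨⟨h.1, h.2.le.trans hst⟩, h.2⟩⟩
  rw [h1, setIntegral_indicator measurableSet_Iio, h2, intervalIntegral.integral_of_le hs,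
    integral_Ioc_eq_integral_Ioo]

theorem setIntegral_rlKernel_sub_right (b : ℝ) (h : ℝ → E) {τ t : ℝ} (hτ : 0 ≤ τ) (hτt : τ ≤ t) :
    ∫ s in Ioc 0 t, rlKernel b (s - τ) • h s = ∫ s in τ..t, (s - τ) ^ (b - 1) • h s := by
  have h1 : (fun s => rlKernel b (s - τ) • h s) =
      (Ioi τ).indicator fun s => (s - τ) ^ (b - 1) • h s := by
    ext s
    by_cases hs : τ < s
    · rw [indicator_of_mem (show s ∈ Ioi τ from hs), rlKernel_of_pos (sub_pos.2 hs)]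
    · rw [indicator_of_notMem (show s ∉ Ioi τ from hs), rlKernel,
        indicator_of_notMem (by simpa using hs), zero_smul]
  have h2 : Ioc 0 t ∩ Ioi τ = Ioc τ t := by
    ext x
    simp only [mem_inter_iff, mem_Ioc, mem_Ioi]
    exact ⟨fun h => ⟨h.2, h.1.2⟩, fun h => ⟨⟨hτ.trans_lt h.1, h.2⟩, h.1⟩⟩
  rw [h1, setIntegral_indicator measurableSet_Ioi, h2, intervalIntegral.integral_of_le hτt]

theorem setIntegral_rlKernel_sub {b : ℝ} (hb : 0 < b) {s t : ℝ} (hs : 0 ≤ s) (hst : s ≤ t) :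
    ∫ τ in Ioc 0 t, rlKernel b (s - τ) = s ^ b / b := by
  have := setIntegral_rlKernel_sub_left b (fun _ => (1 : ℝ)) hs hst
  simpa [integral_sub_rpow hb] using this

theorem integrableOn_rlKernel_sub {b : ℝ} (hb : 0 < b) (s t : ℝ) :
    IntegrableOn (fun τ => rlKernel b (s - τ)) (Ioc 0 t) := by
  have h1 : (fun τ => rlKernel b (s - τ)) = (Iio s).indicator fun τ => (s - τ) ^ (b - 1) := by
    ext τ
    by_cases hτ : τ < s
    · rw [indicator_of_mem (show τ ∈ Iio s from hτ), rlKernel_of_pos (sub_pos.2 hτ)]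
    · rw [indicator_of_notMem (show τ ∉ Iio s from hτ), rlKernel,
        indicator_of_notMem (by simpa using hτ)]
  rw [h1]
  exact (intervalIntegrable_sub_rpow hb s 0 t).1.indicator measurableSet_Iio

/-- Justifies Fubini in the semigroup law: the inner integral of the nonnegative kernel is s^b/b,
bounded on (0, t], and the remaining kernel is integrable. -/
theorem integrable_rlKernel_mul_rlKernel {a b : ℝ} (ha : 0 < a) (hb : 0 < b) (t : ℝ) :
    Integrable (fun p : ℝ × ℝ => rlKernel a (t - p.1) * rlKernel b (p.1 - p.2))
      ((volume.restrict (Ioc 0 t)).prod (volume.restrict (Ioc 0 t))) := by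
  have hm : Measurable fun p : ℝ × ℝ => rlKernel a (t - p.1) * rlKernel b (p.1 - p.2) :=
    ((measurable_rlKernel a).comp (measurable_const.sub measurable_fst)).mul
      ((measurable_rlKernel b).comp (measurable_fst.sub measurable_snd))
  rw [integrable_prod_iff hm.aestronglyMeasurable]
  refine ⟨Eventually.of_forall fun s =>
    (integrableOn_rlKernel_sub hb s t).const_mul (rlKernel a (t - s)), ?_⟩
  have h1 : IntegrableOn (fun s => s ^ b / b * rlKernel a (t - s)) (Ioc 0 t) := by
    refine Integrable.bdd_mul (c := t ^ b / b) (integrableOn_rlKernel_sub ha t t)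
      ((measurable_id.pow_const b).div_const b).aestronglyMeasurable ?_
    refine (ae_restrict_iff' measurableSet_Ioc).2 (Eventually.of_forall fun s hs => ?_)
    have := Real.rpow_nonneg hs.1.le b
    rw [Real.norm_of_nonneg (by positivity)]
    gcongr
    · exact hs.1.le
    · exact hs.2
  refine h1.congr ((ae_restrict_iff' measurableSet_Ioc).2 (Eventually.of_forall fun s hs => ?_))
  simp only [norm_mul, Real.norm_of_nonneg (rlKernel_nonneg _ _)]
  rw [integral_const_mul, setIntegral_rlKernel_sub hb hs.1.le hs.2, mul_comm]

/-- The semigroup law of fractional integrals. -/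
theorem rlIntegral_rlIntegral [CompleteSpace E] {a b : ℝ} (ha : 0 < a) (hb : 0 < b) {g : ℝ → E} {t : ℝ}
    (ht : 0 ≤ t) (hg : ContinuousOn g (Icc 0 t)) :
    rlIntegral a (rlIntegral b g) t = rlIntegral (a + b) g t := by
  obtain ⟨M, hM⟩ := isCompact_Icc.exists_bound_of_continuousOn hg
  have hgm : AEStronglyMeasurable g (volume.restrict (Ioc 0 t)) :=
    (hg.mono Ioc_subset_Icc_self).aestronglyMeasurable measurableSet_Ioc
  have hint : Integrable (Function.uncurry fun s τ : ℝ =>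
      (rlKernel a (t - s) * rlKernel b (s - τ)) • g τ)
      ((volume.restrict (Ioc 0 t)).prod (volume.restrict (Ioc 0 t))) := by
    refine Integrable.smul_bdd (integrable_rlKernel_mul_rlKernel ha hb t) M hgm.comp_snd ?_
    have : ∀ᵐ τ ∂(volume.restrict (Ioc 0 t)), ‖g τ‖ ≤ M :=
      (ae_restrict_iff' measurableSet_Ioc).2 (Eventually.of_forall fun τ hτ =>
        hM τ (Ioc_subset_Icc_self hτ))
    exact Measure.quasiMeasurePreserving_snd.ae this
  have hswap := integral_integral_swap hint
  have hL : ∫ s in Ioc 0 t, ∫ τ in Ioc 0 t, (rlKernel a (t - s) * rlKernel b (s - τ)) • g τ =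
      ∫ s in (0 : ℝ)..t, (t - s) ^ (a - 1) • ∫ τ in (0 : ℝ)..s, (s - τ) ^ (b - 1) • g τ := by
    rw [← setIntegral_rlKernel_sub_left a _ ht le_rfl]
    refine setIntegral_congr_fun measurableSet_Ioc fun s hs => ?_
    simp only [mul_smul]
    rw [integral_smul, setIntegral_rlKernel_sub_left b g hs.1.le hs.2]
  have hR : ∫ τ in Ioc 0 t, ∫ s in Ioc 0 t, (rlKernel a (t - s) * rlKernel b (s - τ)) • g τ =
      (Real.Gamma a * Real.Gamma b / Real.Gamma (a + b)) •
        ∫ τ in (0 : ℝ)..t, (t - τ) ^ (a + b - 1) • g τ := by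
    rw [intervalIntegral.integral_of_le ht, integral_Ioc_eq_integral_Ioo,
      integral_Ioc_eq_integral_Ioo, ← integral_smul]
    refine setIntegral_congr_fun measurableSet_Ioo fun τ hτ => ?_
    rw [integral_smul_const, smul_smul]
    congr 1
    have h1 := setIntegral_rlKernel_sub_right b (fun s => rlKernel a (t - s)) hτ.1.le hτ.2.le
    simp only [smul_eq_mul] at h1
    simp only [mul_comm (rlKernel a _)]
    rw [h1, mul_comm, ← integral_sub_rpow_mul_sub_rpow ha hb hτ.2,
      intervalIntegral.integral_of_le hτ.2.le, intervalIntegral.integral_of_le hτ.2.le,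
      integral_Ioc_eq_integral_Ioo, integral_Ioc_eq_integral_Ioo]
    refine setIntegral_congr_fun measurableSet_Ioo fun s hs => ?_
    rw [rlKernel_of_pos (sub_pos.2 hs.2), mul_comm]
  rw [hL, hR] at hswap
  have hΓa : Real.Gamma a ≠ 0 := (Real.Gamma_pos_of_pos ha).ne'
  have hΓb : Real.Gamma b ≠ 0 := (Real.Gamma_pos_of_pos hb).ne'
  simp only [rlIntegral]
  simp only [smul_comm _ (Real.Gamma b)⁻¹]
  rw [intervalIntegral.integral_smul, hswap, smul_smul, smul_smul]
  congr 1
  field_simp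

theorem rlIntegral_one (g : ℝ → E) (t : ℝ) : rlIntegral 1 g t = ∫ s in (0 : ℝ)..t, g s := by
  simp [rlIntegral]

end Semigroup

/-! ### From the Caputo equation to a Volterra equation -/

section CaputoVolterra

theorem rlIntegral_congr {E : Type*} [NormedAddCommGroup E] [NormedSpace ℝ E] {a : ℝ}
    {f g : ℝ → E} {t : ℝ} (ht : 0 ≤ t) (h : EqOn f g (Icc 0 t)) :
    rlIntegral a f t = rlIntegral a g t := by
  rw [rlIntegral, rlIntegral]
  congr 1
  refine intervalIntegral.integral_congr fun s hs => ?_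
  rw [uIcc_of_le ht] at hs
  simp only [h hs]

theorem caputoIntegral_eq_rlIntegral {E : Type*} [NormedAddCommGroup E] [NormedSpace ℝ E] {α : ℝ}
    (hα : α < 2) (u : ℝ → E) (t : ℝ) :
    caputoIntegral α u t = Real.Gamma (2 - α) • rlIntegral (2 - α) (halfLineDeriv u) t := by
  have hΓ : Real.Gamma (2 - α) ≠ 0 := (Real.Gamma_pos_of_pos (by linarith)).ne'
  rw [rlIntegral, smul_smul, mul_inv_cancel₀ hΓ, one_smul, caputoIntegral]
  congr! 4
  ring

/-- The Caputo integral is only assumed differentiable for t > 0; this supplies the continuity at 0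
needed to integrate its derivative from 0. -/
theorem tendsto_rlIntegral_zero {E : Type*} [NormedAddCommGroup E] [NormedSpace ℝ E] {a : ℝ}
    (ha : 0 < a) {g : ℝ → E} (hg : ContinuousOn g (Ici 0)) :
    Tendsto (rlIntegral a g) (𝓝[≥] 0) (𝓝 0) := by
  obtain ⟨M, hM⟩ := isCompact_Icc.exists_bound_of_continuousOn
    (hg.mono (Icc_subset_Ici_self : Icc (0 : ℝ) 1 ⊆ _))
  have hlim : Tendsto (fun t : ℝ => |(Real.Gamma a)⁻¹| * (t ^ a / a * M)) (𝓝[≥] 0) (𝓝 0) := by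
    have hc : Continuous fun t : ℝ => |(Real.Gamma a)⁻¹| * (t ^ a / a * M) :=
      (((Real.continuous_rpow_const ha.le).div_const a).mul_const M).const_mul _
    have := hc.tendsto 0
    simp only [Real.zero_rpow ha.ne', zero_div, zero_mul, mul_zero] at this
    exact this.mono_left nhdsWithin_le_nhds
  refine squeeze_zero_norm' ?_ hlim
  filter_upwards [Icc_mem_nhdsGE (show (0 : ℝ) < 1 by norm_num)] with t ht
  rw [rlIntegral, norm_smul, Real.norm_eq_abs, ← integral_sub_rpow ha,
    ← intervalIntegral.integral_mul_const]
  gcongr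
  refine intervalIntegral.norm_integral_le_of_norm_le ht.1 (Eventually.of_forall fun s hs => ?_)
    ((intervalIntegrable_sub_rpow ha t 0 t).mul_const M)
  have h0 : 0 ≤ (t - s) ^ (a - 1) := Real.rpow_nonneg (by linarith [hs.2]) _
  rw [norm_smul, Real.norm_of_nonneg h0]
  gcongr
  exact hM s ⟨hs.1.le, hs.2.trans ht.2⟩

theorem integral_halfLineDeriv {E : Type*} [NormedAddCommGroup E] [NormedSpace ℝ E]
    [CompleteSpace E] {u : ℝ → E} (hu : ContDiffOn ℝ 1 u (Ici 0)) {t : ℝ} (ht : 0 ≤ t) :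
    ∫ s in (0 : ℝ)..t, halfLineDeriv u s = u t - u 0 := by
  have hD : ContinuousOn (halfLineDeriv u) (Ici 0) :=
    hu.continuousOn_derivWithin (uniqueDiffOn_Ici 0) le_rfl
  refine intervalIntegral.integral_eq_sub_of_hasDerivAt_of_le ht
    (hu.continuousOn.mono Icc_subset_Ici_self) (fun x hx => ?_) ?_
  · exact ((hu.differentiableOn one_ne_zero) x hx.1.le).hasDerivWithinAt.hasDerivAt
      (Ici_mem_nhds hx.1)
  · refine ContinuousOn.intervalIntegrable ?_
    rw [uIcc_of_le ht]
    exact hD.mono Icc_subset_Ici_self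

variable {H : Type*} [NormedAddCommGroup H] [InnerProductSpace ℂ H] [CompleteSpace H]

/-- A strong solution, compressed by an operator which intertwines `A` with a bounded operator,
solves a Volterra equation. -/
theorem IsStrongSolution.volterra {A : H →ₗ.[ℂ] H} {α : ℝ} (hα₁ : 1 < α) (hα₂ : α < 2)
    {f u : ℝ → H} (hu : IsStrongSolution A α f u) (hf : ContinuousOn f (Ici 0))
    {P B : H →L[ℂ] H} (hPB : ∀ x : A.domain, P (A x) = B (P x)) {t : ℝ} (ht : 0 ≤ t) :
    P (u t) = rlIntegral α (fun s => P (f s) - B (P (u s))) t := by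
  set D := halfLineDeriv u with hDdef
  set q : ℝ → H := fun s => P (f s) - B (P (u s)) with hq
  have hD : ContinuousOn D (Ici 0) :=
    hu.contDiffOn.continuousOn_derivWithin (uniqueDiffOn_Ici 0) le_rfl
  have hqc : ContinuousOn q (Ici 0) :=
    (P.continuous.comp_continuousOn hf).sub
      (B.continuous.comp_continuousOn (P.continuous.comp_continuousOn hu.contDiffOn.continuousOn))
  have hPD : ContinuousOn (fun s => P (D s)) (Ici 0) := P.continuous.comp_continuousOn hD
  set PR : H →L[ℝ] H := P.restrictScalars ℝ
  have hΓ : Real.Gamma (2 - α) ≠ 0 := (Real.Gamma_pos_of_pos (by linarith)).ne'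
  -- Both sides vanish at 0 and have derivative `q` on (0, ∞), by the equation and the intertwining
  -- P A = B P.
  have hC : ∀ s, 0 ≤ s → rlIntegral (2 - α) (fun s => P (D s)) s = rlIntegral 1 q s := by
    intro s hs
    have h1 : rlIntegral (2 - α) (fun s => P (D s)) s = P (rlIntegral (2 - α) D s) :=
      PR.rlIntegral_comp (by linarith) hs (hD.mono Icc_subset_Ici_self)
    have h2 : ∀ s, rlIntegral (2 - α) D s = (Real.Gamma (2 - α))⁻¹ • caputoIntegral α u s := by
      intro s
      rw [caputoIntegral_eq_rlIntegral hα₂, smul_smul, inv_mul_cancel₀ hΓ, one_smul]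
    have hd : ∀ x, 0 < x → HasDerivAt (fun s => P (rlIntegral (2 - α) D s)) (q x) x := by
      intro x hx
      have hdiff : HasDerivAt (caputoIntegral α u) (deriv (caputoIntegral α u) x) x :=
        ((hu.contDiffOn_caputoIntegral.differentiableOn one_ne_zero).differentiableAt
          (Ioi_mem_nhds hx)).hasDerivAt
      have h3 := PR.hasFDerivAt.comp_hasDerivAt x (hdiff.const_smul (Real.Gamma (2 - α))⁻¹)
      have h4 := hu.equation x hx
      rw [caputoDeriv, hu.initial_deriv, smul_zero, sub_zero] at h4
      have h5 : q x = PR ((Real.Gamma (2 - α))⁻¹ • deriv (caputoIntegral α u) x) := by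
        rw [eq_sub_of_add_eq h4]
        change P (f x) - B (P (u x)) = P _
        rw [map_sub, hPB]
      rw [h5]
      refine h3.congr_of_eventuallyEq (Eventually.of_forall fun y => ?_)
      simp only [h2 y]
      rfl
    rw [h1, rlIntegral_one]
    have hlim := tendsto_rlIntegral_zero (a := 2 - α) (by linarith) hD
    have h0 : rlIntegral (2 - α) D 0 = 0 := by simp [rlIntegral]
    have := intervalIntegral.integral_eq_sub_of_hasDerivAt_of_le hs
      (f := fun s => P (rlIntegral (2 - α) D s)) (f' := q) ?_ (fun x hx => hd x hx.1) ?_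
    · rw [this, h0, map_zero, sub_zero]
    · intro x hx
      rcases hx.1.eq_or_lt with rfl | hx0
      · refine ContinuousWithinAt.mono (t := Ici 0) ?_ Icc_subset_Ici_self
        have : Tendsto (fun s => P (rlIntegral (2 - α) D s)) (𝓝[≥] 0) (𝓝 (P 0)) :=
          (P.continuous.tendsto 0).comp hlim
        rw [ContinuousWithinAt, h0]
        exact this
      · exact (hd x hx0).continuousAt.continuousWithinAt
    · refine ContinuousOn.intervalIntegrable ?_
      rw [uIcc_of_le hs]
      exact hqc.mono Icc_subset_Ici_self
  -- Applying J^(α-1) to J^(2-α) P u' = J^1 q gives J^1 P u' = J^α q, and the left side is P u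
  -- because u(0) = 0.
  have hL := rlIntegral_rlIntegral (a := α - 1) (b := 2 - α) (by linarith) (by linarith) ht
    (hPD.mono Icc_subset_Ici_self)
  have hR := rlIntegral_rlIntegral (a := α - 1) (b := 1) (by linarith) one_pos ht
    (hqc.mono Icc_subset_Ici_self)
  rw [rlIntegral_congr ht (fun s hs => hC s hs.1), hR] at hL
  rw [show α - 1 + 1 = α by ring, show α - 1 + (2 - α) = 1 by ring] at hL
  rw [hL]
  have h6 : rlIntegral 1 (fun s => P (D s)) t = P (rlIntegral 1 D t) :=
    PR.rlIntegral_comp one_pos ht (hD.mono Icc_subset_Ici_self)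
  rw [h6, rlIntegral_one, integral_halfLineDeriv hu.contDiffOn ht, hu.initial, sub_zero]

end CaputoVolterra

/-! ### Laplace transforms of powers and of Mittag-Leffler functions -/

section Laplace

theorem integrableOn_rpow_mul_exp_neg {a r : ℝ} (ha : -1 < a) (hr : 0 < r) :
    IntegrableOn (fun t : ℝ => t ^ a * Real.exp (-(r * t))) (Ioi 0) := by
  simpa using integrableOn_rpow_mul_exp_neg_mul_rpow (p := 1) ha one_pos hr

theorem norm_rpow_mul_cexp {a t : ℝ} (ht : 0 < t) (s : ℂ) :
    ‖((t ^ a : ℝ) : ℂ) * Complex.exp (-(s * t))‖ = t ^ a * Real.exp (-(s.re * t)) := by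
  rw [norm_mul, Complex.norm_exp, Complex.norm_real, Real.norm_of_nonneg (by positivity)]
  simp

theorem measurable_rpow_mul_cexp (a : ℝ) (s : ℂ) :
    Measurable fun t : ℝ => ((t ^ a : ℝ) : ℂ) * Complex.exp (-(s * t)) := by
  fun_prop

theorem integrableOn_rpow_mul_cexp {a : ℝ} (ha : -1 < a) {s : ℂ} (hs : 0 < s.re) :
    IntegrableOn (fun t : ℝ => ((t ^ a : ℝ) : ℂ) * Complex.exp (-(s * t))) (Ioi 0) := by
  refine (integrableOn_rpow_mul_exp_neg ha hs).mono'
    (measurable_rpow_mul_cexp a s).aestronglyMeasurable ?_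
  refine (ae_restrict_iff' measurableSet_Ioi).2 (Eventually.of_forall fun t ht => ?_)
  rw [norm_rpow_mul_cexp ht]

theorem differentiableAt_laplace_rpow {a : ℝ} (ha : -1 < a) {s : ℂ} (hs : 0 < s.re) :
    DifferentiableAt ℂ
      (fun s : ℂ => ∫ t in Ioi (0 : ℝ), ((t ^ a : ℝ) : ℂ) * Complex.exp (-(s * t))) s := by
  have hball : {z : ℂ | s.re / 2 < z.re} ∈ 𝓝 s :=
    (isOpen_lt continuous_const Complex.continuous_re).mem_nhds (by simp; linarith)
  refine (hasDerivAt_integral_of_dominated_loc_of_deriv_le hball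
    (F' := fun z t => ((t ^ a : ℝ) : ℂ) * (Complex.exp (-(z * t)) * -(t : ℂ)))
    (bound := fun t => t ^ (a + 1) * Real.exp (-(s.re / 2 * t)))
    (Eventually.of_forall fun z => (measurable_rpow_mul_cexp a z).aestronglyMeasurable)
    (integrableOn_rpow_mul_cexp ha hs) ?_ ?_ (integrableOn_rpow_mul_exp_neg (by linarith)
      (by linarith)) ?_).2.differentiableAt
  · refine Measurable.aestronglyMeasurable ?_
    fun_prop
  · refine (ae_restrict_iff' measurableSet_Ioi).2 (Eventually.of_forall fun t ht z hz => ?_)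
    rw [← mul_assoc, norm_mul, norm_rpow_mul_cexp ht, norm_neg, Complex.norm_real,
      Real.norm_of_nonneg (le_of_lt ht), Real.rpow_add_one (ne_of_gt ht)]
    have h1 : Real.exp (-(z.re * t)) ≤ Real.exp (-(s.re / 2 * t)) := by
      rw [Real.exp_le_exp, neg_le_neg_iff]
      exact mul_le_mul_of_nonneg_right (le_of_lt hz) (le_of_lt ht)
    have h2 : 0 < t ^ a := Real.rpow_pos_of_pos ht a
    have h3 : 0 < t := ht
    calc t ^ a * Real.exp (-(z.re * t)) * t ≤ t ^ a * Real.exp (-(s.re / 2 * t)) * t := by gcongr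
      _ = _ := by ring
  · refine Eventually.of_forall fun t z _ => ?_
    have h1 : HasDerivAt (fun z : ℂ => -(z * t)) (-(t : ℂ)) z := by
      have := ((hasDerivAt_id z).mul_const (t : ℂ)).fun_neg
      simpa using this
    exact h1.cexp.const_mul _

/-- Both sides are analytic in the right half-plane and agree on the positive reals, where the
integral is Euler's; the identity theorem does the rest. -/
theorem laplace_rpow {a : ℝ} (ha : -1 < a) {s : ℂ} (hs : 0 < s.re) :
    ∫ t in Ioi (0 : ℝ), ((t ^ a : ℝ) : ℂ) * Complex.exp (-(s * t)) =
      (Real.Gamma (a + 1) : ℂ) * s ^ (-(a + 1) : ℂ) := by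
  have hopen : IsOpen {z : ℂ | 0 < z.re} := isOpen_lt continuous_const Complex.continuous_re
  have hconv : Convex ℝ {z : ℂ | 0 < z.re} := convex_halfSpace_re_gt 0
  have h1 : AnalyticOnNhd ℂ
      (fun s : ℂ => ∫ t in Ioi (0 : ℝ), ((t ^ a : ℝ) : ℂ) * Complex.exp (-(s * t)))
      {z : ℂ | 0 < z.re} :=
    DifferentiableOn.analyticOnNhd
      (fun z hz => (differentiableAt_laplace_rpow ha hz).differentiableWithinAt) hopen
  have h2 : AnalyticOnNhd ℂ (fun s : ℂ => (Real.Gamma (a + 1) : ℂ) * s ^ (-(a + 1) : ℂ))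
      {z : ℂ | 0 < z.re} := by
    refine DifferentiableOn.analyticOnNhd (fun z hz => ?_) hopen
    refine DifferentiableAt.differentiableWithinAt ?_
    exact (differentiableAt_id.cpow_const (Or.inl hz)).const_mul _
  refine h1.eqOn_of_preconnected_of_frequently_eq h2 hconv.isPreconnected (z₀ := 1) (by simp) ?_ hs
  have hreal : ∀ r : ℝ, 0 < r →
      ∫ t in Ioi (0 : ℝ), ((t ^ a : ℝ) : ℂ) * Complex.exp (-((r : ℂ) * t)) =
      (Real.Gamma (a + 1) : ℂ) * (r : ℂ) ^ (-(a + 1) : ℂ) := by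
    intro r hr
    have h := Real.integral_rpow_mul_exp_neg_mul_Ioi (a := a + 1) (by linarith) hr
    rw [add_sub_cancel_right] at h
    have h3 : ∀ t : ℝ, ((t ^ a : ℝ) : ℂ) * Complex.exp (-((r : ℂ) * t)) =
        ((t ^ a * Real.exp (-(r * t)) : ℝ) : ℂ) := fun t => by push_cast; ring_nf
    simp only [h3]
    rw [integral_complex_ofReal, h, mul_comm]
    push_cast
    rw [one_div, Real.inv_rpow hr.le, ← Real.rpow_neg hr.le, Complex.ofReal_cpow hr.le]
    push_cast
    rfl
  have hseq : Tendsto (fun n : ℕ => ((1 + 1 / ((n : ℝ) + 1) : ℝ) : ℂ)) atTop (𝓝[≠] 1) := by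
    refine tendsto_nhdsWithin_iff.2 ⟨?_, Eventually.of_forall fun n => ?_⟩
    · have := (tendsto_one_div_add_atTop_nhds_zero_nat (𝕜 := ℝ)).const_add 1
      simpa [Function.comp_def] using (Complex.continuous_ofReal.tendsto _).comp this
    · have h : (1 + 1 / ((n : ℝ) + 1) : ℝ) ≠ 1 := by
        have : 0 < 1 / ((n : ℝ) + 1) := by positivity
        linarith
      simp only [mem_compl_iff, mem_singleton_iff]
      exact_mod_cast h
  exact hseq.frequently (Frequently.of_forall fun n => hreal _ (by positivity))

/-- The Gamma factors cancel termwise, leaving a geometric series in c/s^α; ‖c‖ ≤ 1 < Re s makes it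
converge and permits exchanging sum and integral. -/
theorem laplace_fracSeries {α : ℝ} (hα : 1 < α) {c : ℂ} (hc : ‖c‖ ≤ 1) {s : ℂ} (hs : 1 < s.re) :
    ∫ t in Ioi (0 : ℝ), fracSeries α (fun k => c ^ k) t * Complex.exp (-(s * t)) =
      s ^ (α - 1 : ℂ) / (s ^ (α : ℂ) - c) := by
  have hs0 : s ≠ 0 := by rintro rfl; simp at hs; linarith
  have hs1 : 1 < ‖s‖ := hs.trans_le (Complex.re_le_norm s)
  have hpow : 1 < ‖s ^ (α : ℂ)‖ := by
    rw [Complex.norm_cpow_real]; exact Real.one_lt_rpow hs1 (by linarith)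
  have hsα : s ^ (α : ℂ) ≠ 0 := by
    intro h; rw [h, norm_zero] at hpow; linarith
  set F : ℕ → ℝ → ℂ := fun k t => (c ^ k / (Real.Gamma (α * k + 1) : ℂ)) *
    (((t ^ (α * k) : ℝ) : ℂ) * Complex.exp (-(s * t))) with hF
  have hak : ∀ k : ℕ, -1 < α * k := fun k => by
    have : 0 ≤ α * k := by positivity
    linarith
  have hint : ∀ k, IntegrableOn (F k) (Ioi 0) := fun k =>
    (integrableOn_rpow_mul_cexp (hak k) (by linarith)).const_mul _
  have hsum : Summable fun k => ∫ t in Ioi (0 : ℝ), ‖F k t‖ := by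
    have hr : (1 / s.re) ^ α < 1 := Real.rpow_lt_one (by positivity)
      ((div_lt_one (by linarith)).2 hs) (by linarith)
    refine Summable.of_nonneg_of_le (fun k => integral_nonneg fun t => norm_nonneg _) (fun k => ?_)
      ((summable_geometric_of_lt_one (by positivity) hr).mul_left (1 / s.re))
    have hΓ := Gamma_mul_add_one_pos hα.le k
    have : ∫ t in Ioi (0 : ℝ), ‖F k t‖ = ‖c‖ ^ k / Real.Gamma (α * k + 1) *
        ∫ t in Ioi (0 : ℝ), t ^ (α * k + 1 - 1) * Real.exp (-(s.re * t)) := by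
      rw [← integral_const_mul]
      refine setIntegral_congr_fun measurableSet_Ioi fun t ht => ?_
      simp only [hF]
      rw [norm_mul, norm_rpow_mul_cexp ht, norm_div, norm_pow, Complex.norm_real,
        Real.norm_of_nonneg hΓ.le, add_sub_cancel_right]
    rw [this, Real.integral_rpow_mul_exp_neg_mul_Ioi (by linarith [hak k]) (by linarith),
      Real.rpow_add (by positivity), Real.rpow_one, Real.rpow_mul_natCast (by positivity)]
    have hck : ‖c‖ ^ k ≤ 1 := pow_le_one₀ (norm_nonneg _) hc
    calc ‖c‖ ^ k / Real.Gamma (α * k + 1) *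
        (((1 / s.re) ^ α) ^ k * (1 / s.re) * Real.Gamma (α * k + 1))
        = ‖c‖ ^ k * (1 / s.re * ((1 / s.re) ^ α) ^ k) := by field_simp
      _ ≤ 1 * (1 / s.re * ((1 / s.re) ^ α) ^ k) := by gcongr
      _ = _ := one_mul _
  have h := hasSum_integral_of_summable_integral_norm hint hsum
  have hL : ∫ t in Ioi (0 : ℝ), fracSeries α (fun k => c ^ k) t * Complex.exp (-(s * t)) =
      ∫ t in Ioi (0 : ℝ), ∑' k, F k t := by
    refine setIntegral_congr_fun measurableSet_Ioi fun t ht => ?_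
    simp only [fracSeries, hF]
    rw [← tsum_mul_right]
    refine tsum_congr fun k => ?_
    rw [Real.rpow_mul_natCast (le_of_lt ht), Complex.real_smul]
    push_cast
    ring
  have hR : HasSum (fun k => ∫ t in Ioi (0 : ℝ), F k t) (s⁻¹ * (1 - c * (s ^ (α : ℂ))⁻¹)⁻¹) := by
    have hlt : ‖c * (s ^ (α : ℂ))⁻¹‖ < 1 := by
      rw [norm_mul, norm_inv]
      calc ‖c‖ * ‖s ^ (α : ℂ)‖⁻¹ ≤ 1 * ‖s ^ (α : ℂ)‖⁻¹ := by gcongr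
        _ < 1 := by rw [one_mul]; exact inv_lt_one_of_one_lt₀ hpow
    refine ((hasSum_geometric_of_norm_lt_one hlt).mul_left s⁻¹).congr_fun fun k => ?_
    have hΓ : (Real.Gamma (α * k + 1) : ℂ) ≠ 0 := by
      exact_mod_cast (Gamma_mul_add_one_pos hα.le k).ne'
    simp only [hF]
    rw [integral_const_mul, laplace_rpow (hak k) (by linarith)]
    push_cast
    rw [neg_add, Complex.cpow_add _ _ hs0, Complex.cpow_neg_one, Complex.cpow_neg,
      Complex.cpow_mul_nat, mul_pow, inv_pow]
    field_simp
  rw [hL, ← h.tsum_eq, hR.tsum_eq, Complex.cpow_sub _ _ hs0, Complex.cpow_one]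
  have h3 : s ^ (α : ℂ) - c ≠ 0 := by
    intro h0
    rw [sub_eq_zero] at h0
    rw [h0] at hpow
    linarith
  have h4 : 1 - c * (s ^ (α : ℂ))⁻¹ ≠ 0 := by
    intro h0
    apply h3
    field_simp at h0
    simpa using h0
  field_simp

/-- A nonzero Bochner integral forces integrability, since the integral of a nonintegrable function
is 0 by convention. -/
theorem integrableOn_fracSeries_mul_cexp {α : ℝ} (hα : 1 < α) {c : ℂ} (hc : ‖c‖ ≤ 1) {s : ℂ}
    (hs : 1 < s.re) :
    IntegrableOn (fun t : ℝ => fracSeries α (fun k => c ^ k) t * Complex.exp (-(s * t)))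
      (Ioi 0) := by
  have hs0 : s ≠ 0 := by rintro rfl; simp at hs; linarith
  have hs1 : 1 < ‖s‖ := hs.trans_le (Complex.re_le_norm s)
  have hpow : 1 < ‖s ^ (α : ℂ)‖ := by
    rw [Complex.norm_cpow_real]; exact Real.one_lt_rpow hs1 (by linarith)
  refine Integrable.of_integral_ne_zero ?_
  rw [laplace_fracSeries hα hc hs]
  refine div_ne_zero (by simp [Complex.cpow_eq_zero_iff, hs0]) fun h0 => ?_
  rw [sub_eq_zero] at h0
  rw [h0] at hpow
  linarith

end Laplace

/-! ### Laplace inversion and decay at infinity -/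

section InverseLaplace

theorem integrable_vertical {Ψ : ℂ → ℂ} {C x : ℝ} (hx : 0 ≤ x)
    (hc : ContinuousOn Ψ {s | 0 ≤ s.re})
    (hb : ∀ s : ℂ, s.re = x → ‖Ψ s‖ ≤ C / (1 + s.im ^ 2)) :
    Integrable fun y : ℝ => Ψ (x + y * Complex.I) := by
  have hcont : Continuous fun y : ℝ => Ψ (x + y * Complex.I) :=
    hc.comp_continuous (by fun_prop) (fun y => by simpa using hx)
  refine (integrable_inv_one_add_sq.const_mul C).mono' hcont.aestronglyMeasurable
    (Eventually.of_forall fun y => ?_)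
  simpa [div_eq_mul_inv] using hb (x + y * Complex.I) (by simp)

/-- Shift of the contour of integration from the line `Re s = x` to the imaginary axis. -/
theorem integral_vertical_eq {Ψ : ℂ → ℂ} {C x : ℝ} (hx : 0 ≤ x)
    (hc : ContinuousOn Ψ {s | 0 ≤ s.re}) (hd : DifferentiableOn ℂ Ψ {s | 0 < s.re})
    (hb : ∀ s : ℂ, 0 ≤ s.re → s.re ≤ x → ‖Ψ s‖ ≤ C / (1 + s.im ^ 2)) :
    ∫ y : ℝ, Ψ (x + y * Complex.I) = ∫ y : ℝ, Ψ (y * Complex.I) := by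
  have hi1 := integrable_vertical hx hc (fun s hs => hb s (by rw [hs]; exact hx) hs.le)
  have hi0 := integrable_vertical le_rfl hc (fun s hs => hb s hs.ge (by rw [hs]; exact hx))
  simp only [Complex.ofReal_zero, zero_add] at hi0
  have ht1 := intervalIntegral_tendsto_integral hi1
    (tendsto_neg_atTop_atBot.comp tendsto_natCast_atTop_atTop)
    (tendsto_natCast_atTop_atTop (R := ℝ))
  have ht0 := intervalIntegral_tendsto_integral hi0
    (tendsto_neg_atTop_atBot.comp tendsto_natCast_atTop_atTop)
    (tendsto_natCast_atTop_atTop (R := ℝ))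
  have hsub := (ht1.sub ht0).const_mul Complex.I
  have hzero : Tendsto (fun n : ℕ => 2 * (C / (1 + (n : ℝ) ^ 2) * |x - 0|)) atTop (𝓝 0) := by
    have h1 : Tendsto (fun n : ℕ => 1 + (n : ℝ) ^ 2) atTop atTop :=
      tendsto_atTop_add_const_left _ _
        ((tendsto_pow_atTop (by norm_num)).comp tendsto_natCast_atTop_atTop)
    simpa using ((h1.const_div_atTop C).mul_const |x - 0|).const_mul 2
  have hlim := squeeze_zero_norm (fun n : ℕ => ?_) hzero (f := fun n : ℕ => Complex.I *
      ((∫ y in (-(n : ℝ))..(n : ℝ), Ψ (x + y * Complex.I)) -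
        ∫ y in (-(n : ℝ))..(n : ℝ), Ψ (y * Complex.I)))
  · have := tendsto_nhds_unique hsub hlim
    simpa [sub_eq_zero] using this
  -- Cauchy on the rectangle 0 ≤ Re s ≤ x, |Im s| ≤ n; the two horizontal sides are O(1/n²).
  · have hrect := Complex.integral_boundary_rect_eq_zero_of_continuousOn_of_differentiableOn Ψ
      (-(n : ℝ) * Complex.I) (x + (n : ℝ) * Complex.I) ?_ ?_
    · simp only [Complex.add_re, Complex.add_im, Complex.mul_re, Complex.mul_im, Complex.neg_re,
        Complex.neg_im, Complex.ofReal_re, Complex.ofReal_im, Complex.I_re, Complex.I_im, mul_zero,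
        mul_one, sub_zero, add_zero, zero_add, neg_zero, smul_eq_mul, Complex.ofReal_zero] at hrect
      have heq : Complex.I * ((∫ y in (-(n : ℝ))..(n : ℝ), Ψ (x + y * Complex.I)) -
          ∫ y in (-(n : ℝ))..(n : ℝ), Ψ (y * Complex.I)) =
          (∫ r in (0 : ℝ)..x, Ψ (r + (n : ℝ) * Complex.I)) -
          ∫ r in (0 : ℝ)..x, Ψ (r + (-(n : ℝ) : ℝ) * Complex.I) := by
        rw [mul_sub]
        linear_combination hrect
      have hside : ∀ m : ℝ, m ^ 2 = (n : ℝ) ^ 2 →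
          ‖∫ r in (0 : ℝ)..x, Ψ (r + m * Complex.I)‖ ≤ C / (1 + (n : ℝ) ^ 2) * |x - 0| := by
        intro m hm
        refine intervalIntegral.norm_integral_le_of_norm_le_const fun r hr => ?_
        rw [uIoc_of_le hx] at hr
        rw [← hm]
        simpa using hb (r + m * Complex.I) (by simpa using hr.1.le) (by simpa using hr.2)
      rw [heq, two_mul]
      exact (norm_sub_le _ _).trans (add_le_add (hside _ rfl) (hside _ (by ring)))
    · refine hc.mono fun s hs => ?_
      have := hs.1
      simp [uIcc_of_le hx] at this
      exact this.1
    · refine hd.mono fun s hs => ?_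
      have := hs.1
      simp [hx] at this
      exact this.1

/-- A function whose Laplace transform extends to a function which is continuous and quadratically
decaying on the closed right half-plane tends to zero. -/
theorem tendsto_zero_of_laplace {f : ℝ → ℂ} {G : ℂ → ℂ} {C x : ℝ} (hx : 0 ≤ x)
    (hf : ContinuousOn f (Ioi 0))
    (hint : IntegrableOn (fun t : ℝ => f t * Complex.exp (-(x * t))) (Ioi 0))
    (hlap : ∀ s : ℂ, s.re = x → ∫ t in Ioi (0 : ℝ), f t * Complex.exp (-(s * t)) = G s)
    (hGc : ContinuousOn G {s | 0 ≤ s.re}) (hGd : DifferentiableOn ℂ G {s | 0 < s.re})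
    (hGb : ∀ s : ℂ, 0 ≤ s.re → ‖G s‖ ≤ C / (1 + s.im ^ 2)) :
    Tendsto f atTop (𝓝 0) := by
  have hpi : (0 : ℝ) < 2 * Real.pi := by positivity
  have hpi' : (Real.pi : ℂ) ≠ 0 := by exact_mod_cast Real.pi_ne_zero
  -- The Laplace transform on Re s = x is the Fourier transform of this damped function at Im
  -- s/(2π), so Fourier inversion recovers f.
  set φ : ℝ → ℂ := (Ioi (0 : ℝ)).indicator fun t => f t * Complex.exp (-(x * t)) with hφ
  have hφi : Integrable φ := hint.integrable_indicator measurableSet_Ioi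
  have hF : FourierTransform.fourier φ =
      fun ξ : ℝ => G (x + ((2 * Real.pi * ξ : ℝ) : ℂ) * Complex.I) := by
    ext ξ
    rw [Real.fourier_real_eq_integral_exp_smul, ← hlap _ (by simp),
      ← integral_indicator measurableSet_Ioi]
    congr 1
    ext t
    by_cases ht : t ∈ Ioi (0 : ℝ)
    · rw [hφ, indicator_of_mem ht, indicator_of_mem ht, smul_eq_mul, mul_left_comm,
        ← Complex.exp_add]
      congr 2
      push_cast
      ring
    · rw [hφ, indicator_of_notMem ht, indicator_of_notMem ht, smul_zero]
  have hFi : Integrable (FourierTransform.fourier φ) := by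
    rw [hF]
    have h := integrable_vertical hx hGc (fun s hs => hGb s (by rw [hs]; exact hx))
    exact h.comp_mul_left' hpi.ne'
  have hinv : ∀ t : ℝ, 0 < t →
      f t = ((2 * Real.pi)⁻¹ : ℝ) • ∫ y : ℝ, G (y * Complex.I) * Complex.exp (y * Complex.I * t) := by
    intro t ht
    have hcont : ContinuousAt φ t := by
      have h1 : ContinuousAt (fun t : ℝ => f t * Complex.exp (-(x * t))) t :=
        (hf.continuousAt (Ioi_mem_nhds ht)).mul (by fun_prop)
      refine h1.congr ?_
      filter_upwards [Ioi_mem_nhds ht] with y hy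
      rw [hφ, indicator_of_mem hy]
    have h := hφi.fourierInv_fourier_eq hFi hcont
    rw [Real.fourierInv_eq', hF, hφ, indicator_of_mem (show t ∈ Ioi 0 from ht)] at h
    set Ψ : ℂ → ℂ := fun s => G s * Complex.exp (s * t) with hΨ
    have hshift := integral_vertical_eq (Ψ := Ψ) (C := C * Real.exp (x * t)) hx
      (hGc.mul (by fun_prop)) (hGd.mul (by fun_prop)) (fun s hs0 hs1 => by
        rw [hΨ, norm_mul, Complex.norm_exp, mul_div_right_comm]
        refine mul_le_mul (hGb s hs0) ?_ (Real.exp_nonneg _) ((norm_nonneg _).trans (hGb s hs0))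
        rw [Real.exp_le_exp]
        simpa using mul_le_mul_of_nonneg_right hs1 ht.le)
    have hsub := Measure.integral_comp_mul_left
      (fun y : ℝ => Ψ (x + y * Complex.I)) (2 * Real.pi)
    rw [hshift, abs_of_pos (by positivity)] at hsub
    rw [← hsub]
    have h2 : f t = Complex.exp (x * t) * (f t * Complex.exp (-(x * t))) := by
      rw [mul_left_comm, ← Complex.exp_add, add_neg_cancel, Complex.exp_zero, mul_one]
    rw [h2, ← h, ← integral_const_mul]
    congr 1
    ext ξ
    simp only [hΨ, smul_eq_mul]
    rw [mul_comm (Complex.exp (((2 * Real.pi * _ : ℝ) : ℂ) * Complex.I)), mul_left_comm,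
      ← Complex.exp_add]
    congr 2
    simp
    ring
  -- On the imaginary axis the factor exp(st) is purely oscillatory, so the Riemann-Lebesgue lemma
  -- gives decay in t.
  have hRL := Real.tendsto_integral_exp_smul_cocompact (fun y : ℝ => G (y * Complex.I))
  have hw : Tendsto (fun t : ℝ => -(t / (2 * Real.pi))) atTop (cocompact ℝ) :=
    (tendsto_neg_atTop_atBot.comp (tendsto_id.atTop_div_const hpi)).mono_right
      atBot_le_cocompact
  have h0 := (hRL.comp hw).const_smul ((2 * Real.pi)⁻¹ : ℝ)
  rw [smul_zero] at h0
  refine h0.congr' ?_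
  filter_upwards [eventually_gt_atTop 0] with t ht
  rw [hinv t ht]
  simp only [Function.comp_apply]
  congr 1
  refine integral_congr_ae (Eventually.of_forall fun y => ?_)
  simp only
  rw [Circle.smul_def, Real.fourierChar_apply, smul_eq_mul, mul_comm]
  congr 2
  push_cast
  field_simp

end InverseLaplace

/-! ### Asymptotics of the scalar Mittag-Leffler functions -/

section Asymptotics

theorem mem_slitPlane_of_re_nonneg {s : ℂ} (hs : 0 ≤ s.re) (h0 : s ≠ 0) : s ∈ Complex.slitPlane := by
  rw [Complex.mem_slitPlane_iff]
  by_contra! h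
  exact h0 (Complex.ext (le_antisymm h.1 hs) h.2)

theorem continuousWithinAt_cpow_const_of_re_nonneg {a : ℝ} (ha : 0 < a) {s : ℂ} (hs : 0 ≤ s.re)
    (S : Set ℂ) : ContinuousWithinAt (fun z : ℂ => z ^ (a : ℂ)) S s := by
  refine ContinuousAt.continuousWithinAt ?_
  rcases eq_or_ne s 0 with rfl | h0
  · have h := Complex.continuousAt_cpow_zero_of_re_pos (z := (a : ℂ)) (by simpa)
    exact h.comp (f := fun z : ℂ => (z, (a : ℂ))) (by fun_prop)
  · exact continuousAt_id.cpow continuousAt_const (mem_slitPlane_of_re_nonneg hs h0)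

/-- The three fractions behave like 1/s, p/s and (1 - p)/s at infinity. The auxiliary term (1 -
p)/(s + 1), with its pole in the left half-plane, is there to cancel the order 1/s; what remains is
quadratic because each denominator is at least ‖s‖/2. -/
theorem norm_laplace_remainder_le {α : ℝ} (hα : 1 < α) {c : ℂ} (hc : ‖c‖ ≤ 1) (p : ℂ) {s : ℂ}
    (hs : 2 ≤ ‖s‖) :
    ‖s ^ (α - 1 : ℂ) / (s ^ (α : ℂ) - c) - p / (s - Complex.I) - (1 - p) / (s + 1)‖ ≤
      2 * (1 + ‖p‖ + ‖1 - p‖) / ‖s‖ ^ 2 := by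
  have hs0 : s ≠ 0 := by rintro rfl; simp at hs; linarith
  have hn : 0 < ‖s‖ := by linarith
  have h1 : ‖s‖ / 2 ≤ ‖s ^ (α : ℂ) - c‖ := by
    have h := norm_sub_norm_le (s ^ (α : ℂ)) c
    rw [Complex.norm_cpow_real] at h
    have h2 : ‖s‖ ^ (1 : ℝ) ≤ ‖s‖ ^ α := Real.rpow_le_rpow_of_exponent_le (by linarith) hα.le
    rw [Real.rpow_one] at h2
    linarith
  have h2 : ‖s‖ / 2 ≤ ‖s - Complex.I‖ := by
    have h := norm_sub_norm_le s Complex.I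
    rw [Complex.norm_I] at h
    linarith
  have h3 : ‖s‖ / 2 ≤ ‖s + 1‖ := by
    have h := norm_sub_norm_le s (-1)
    rw [norm_neg, norm_one, sub_neg_eq_add] at h
    linarith
  have d1 : s ^ (α : ℂ) - c ≠ 0 := norm_pos_iff.1 (by linarith)
  have d2 : s - Complex.I ≠ 0 := norm_pos_iff.1 (by linarith)
  have d3 : s + 1 ≠ 0 := norm_pos_iff.1 (by linarith)
  have key : s ^ (α - 1 : ℂ) / (s ^ (α : ℂ) - c) - p / (s - Complex.I) - (1 - p) / (s + 1) =
      c / (s * (s ^ (α : ℂ) - c)) + (-(p * Complex.I) / (s * (s - Complex.I)) +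
        (1 - p) / (s * (s + 1))) := by
    rw [Complex.cpow_sub _ _ hs0, Complex.cpow_one]
    field_simp
    ring
  have hdiv : ∀ a b : ℂ, ‖s‖ / 2 ≤ ‖b‖ → ‖a / (s * b)‖ ≤ 2 * ‖a‖ / ‖s‖ ^ 2 := by
    intro a b hb
    rw [norm_div, norm_mul]
    calc ‖a‖ / (‖s‖ * ‖b‖) ≤ ‖a‖ / (‖s‖ * (‖s‖ / 2)) := by gcongr
      _ = _ := by field_simp
  rw [key]
  have e1 := hdiv c _ h1
  have e2 := hdiv (-(p * Complex.I)) _ h2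
  have e3 := hdiv (1 - p) _ h3
  rw [norm_neg, norm_mul, Complex.norm_I, mul_one] at e2
  have e1' : 2 * ‖c‖ / ‖s‖ ^ 2 ≤ 2 * 1 / ‖s‖ ^ 2 := by gcongr
  calc _ ≤ ‖c / (s * (s ^ (α : ℂ) - c))‖ + (‖-(p * Complex.I) / (s * (s - Complex.I))‖ +
        ‖(1 - p) / (s * (s + 1))‖) := (norm_add_le _ _).trans (by gcongr; exact norm_add_le _ _)
    _ ≤ 2 * 1 / ‖s‖ ^ 2 + (2 * ‖p‖ / ‖s‖ ^ 2 + 2 * ‖1 - p‖ / ‖s‖ ^ 2) := by linarith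
    _ = _ := by ring

theorem integrableOn_cexp_mul_cexp {a s : ℂ} (h : a.re < s.re) :
    IntegrableOn (fun t : ℝ => Complex.exp (a * t) * Complex.exp (-(s * t))) (Ioi 0) := by
  have : ∀ t : ℝ, Complex.exp (a * t) * Complex.exp (-(s * t)) = Complex.exp ((a - s) * t) :=
    fun t => by rw [← Complex.exp_add]; congr 1; ring
  simp only [this]
  exact integrableOn_exp_mul_complex_Ioi (by simpa using h) 0

theorem laplace_cexp {a s : ℂ} (h : a.re < s.re) :
    ∫ t in Ioi (0 : ℝ), Complex.exp (a * t) * Complex.exp (-(s * t)) = 1 / (s - a) := by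
  have : ∀ t : ℝ, Complex.exp (a * t) * Complex.exp (-(s * t)) = Complex.exp ((a - s) * t) :=
    fun t => by rw [← Complex.exp_add]; congr 1; ring
  simp only [this]
  rw [integral_exp_mul_complex_Ioi (by simpa using h)]
  rw [show a - s = -(s - a) by ring, neg_div_neg_eq]
  simp

/-- If the Laplace transform of `F(t) = ∑ c ^ k t ^ (α k) / Γ(α k + 1)` has at most one pole `I`, of
residue `p`, in the closed right half-plane, then `F(t) - p exp (i t) → 0`. -/
theorem tendsto_fracSeries_sub_exp {α : ℝ} (hα : 1 < α) {c p : ℂ} (hc : ‖c‖ ≤ 1) {G : ℂ → ℂ}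
    (hGc : ContinuousOn G {s | 0 ≤ s.re}) (hGd : DifferentiableOn ℂ G {s | 0 < s.re})
    (hG : ∀ s : ℂ, 0 ≤ s.re → s ≠ Complex.I →
      G s = s ^ (α - 1 : ℂ) / (s ^ (α : ℂ) - c) - p / (s - Complex.I) - (1 - p) / (s + 1)) :
    Tendsto (fun t : ℝ => fracSeries α (fun k => c ^ k) t - p * Complex.exp (Complex.I * t)) atTop
      (𝓝 0) := by
  have hcomp : IsCompact ({s : ℂ | 0 ≤ s.re} ∩ Metric.closedBall 0 2) :=
    (isCompact_closedBall 0 2).inter_left (isClosed_le continuous_const Complex.continuous_re)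
  obtain ⟨M, hM⟩ := hcomp.exists_bound_of_continuousOn (hGc.mono inter_subset_left)
  have hM0 : 0 ≤ M := (norm_nonneg _).trans (hM 0 (by simp))
  set K : ℝ := 2 * (1 + ‖p‖ + ‖1 - p‖) with hK
  have hK0 : 0 ≤ K := by positivity
  -- For ‖s‖ ≤ 2 one has 1 + (Im s)² ≤ 5 and compactness bounds G by M; for ‖s‖ ≥ 2 one has 1 + (Im
  -- s)² ≤ 2‖s‖² and the remainder bound applies.
  have hGb : ∀ s : ℂ, 0 ≤ s.re → ‖G s‖ ≤ (5 * M + 2 * K) / (1 + s.im ^ 2) := by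
    intro s hs
    have him : s.im ^ 2 ≤ ‖s‖ ^ 2 := by
      rw [← sq_abs]; gcongr; exact Complex.abs_im_le_norm s
    rw [le_div_iff₀ (by positivity)]
    rcases le_total ‖s‖ 2 with h | h
    · have h1 := hM s ⟨hs, by simpa using h⟩
      have h2 : ‖s‖ ^ 2 ≤ 4 := by nlinarith [norm_nonneg s]
      calc ‖G s‖ * (1 + s.im ^ 2) ≤ M * 5 := by gcongr; linarith
        _ ≤ _ := by linarith
    · have hne : s ≠ Complex.I := by rintro rfl; rw [Complex.norm_I] at h; linarith
      have h1 := norm_laplace_remainder_le hα hc p h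
      rw [← hG s hs hne, ← hK] at h1
      have h2 : 4 ≤ ‖s‖ ^ 2 := by nlinarith
      calc ‖G s‖ * (1 + s.im ^ 2) ≤ K / ‖s‖ ^ 2 * (2 * ‖s‖ ^ 2) := by gcongr; linarith
        _ = 2 * K := by field_simp
        _ ≤ _ := by linarith
  set f : ℝ → ℂ := fun t => fracSeries α (fun k => c ^ k) t - p * Complex.exp (Complex.I * t) -
    (1 - p) * Complex.exp (-1 * t) with hf
  have hcν : ∀ k : ℕ, ‖c ^ k‖ ≤ 1 * 1 ^ k := fun k => by
    rw [norm_pow, one_pow, mul_one]; exact pow_le_one₀ (norm_nonneg _) hc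
  have hfc : ContinuousOn f (Ioi 0) :=
    (((continuousOn_fracSeries hα.le hcν).mono Ioi_subset_Ici_self).sub (by fun_prop)).sub
      (by fun_prop)
  have hfe : ∀ s : ℂ, (fun t : ℝ => f t * Complex.exp (-(s * t))) = fun t : ℝ =>
      fracSeries α (fun k => c ^ k) t * Complex.exp (-(s * t)) -
      p * (Complex.exp (Complex.I * t) * Complex.exp (-(s * t))) -
      (1 - p) * (Complex.exp (-1 * t) * Complex.exp (-(s * t))) := by
    intro s; ext t; simp only [hf]; ring
  have i1 : ∀ s : ℂ, s.re = 2 → IntegrableOn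
      (fun t : ℝ => fracSeries α (fun k => c ^ k) t * Complex.exp (-(s * t))) (Ioi 0) :=
    fun s hs => integrableOn_fracSeries_mul_cexp hα hc (by rw [hs]; norm_num)
  have r2 : ∀ s : ℂ, s.re = 2 → Complex.I.re < s.re := fun s hs => by rw [hs]; simp
  have r3 : ∀ s : ℂ, s.re = 2 → (-1 : ℂ).re < s.re := fun s hs => by rw [hs]; simp; norm_num
  have i2 : ∀ s : ℂ, s.re = 2 → IntegrableOn
      (fun t : ℝ => p * (Complex.exp (Complex.I * t) * Complex.exp (-(s * t)))) (Ioi 0) :=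
    fun s hs => (integrableOn_cexp_mul_cexp (r2 s hs)).const_mul p
  have i3 : ∀ s : ℂ, s.re = 2 → IntegrableOn
      (fun t : ℝ => (1 - p) * (Complex.exp (-1 * t) * Complex.exp (-(s * t)))) (Ioi 0) :=
    fun s hs => (integrableOn_cexp_mul_cexp (r3 s hs)).const_mul (1 - p)
  have hlim : Tendsto f atTop (𝓝 0) := by
    refine tendsto_zero_of_laplace (x := 2) (G := G) zero_le_two hfc ?_ (fun s hs => ?_) hGc hGd hGb
    · have h2 : ((2 : ℝ) : ℂ).re = 2 := Complex.ofReal_re 2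
      rw [hfe]
      exact ((i1 _ h2).sub (i2 _ h2)).sub (i3 _ h2)
    · have h12 : IntegrableOn (fun t : ℝ =>
          fracSeries α (fun k => c ^ k) t * Complex.exp (-(s * t)) -
          p * (Complex.exp (Complex.I * t) * Complex.exp (-(s * t)))) (Ioi 0) :=
        (i1 s hs).sub (i2 s hs)
      rw [hfe, integral_sub h12 (i3 s hs), integral_sub (i1 s hs) (i2 s hs),
        integral_const_mul, integral_const_mul, laplace_cexp (r2 s hs), laplace_cexp (r3 s hs),
        laplace_fracSeries hα hc (by rw [hs]; norm_num), hG s (by rw [hs]; norm_num)]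
      · ring
      · rintro rfl; simp at hs
  have hexp : Tendsto (fun t : ℝ => (1 - p) * Complex.exp (-1 * t)) atTop (𝓝 0) := by
    have : Tendsto (fun t : ℝ => Complex.exp (-1 * t)) atTop (𝓝 0) := by
      rw [tendsto_zero_iff_norm_tendsto_zero]
      simpa [Complex.norm_exp] using Real.tendsto_exp_neg_atTop_nhds_zero
    simpa using this.const_mul (1 - p)
  have := hlim.add hexp
  simpa [hf] using this

theorem Complex.abs_arg_le_of_re_nonneg {s : ℂ} (hs : 0 ≤ s.re) : |s.arg| ≤ Real.pi / 2 :=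
  Complex.abs_arg_le_pi_div_two_iff.2 hs

theorem cpow_ne_neg_one_of_re_nonneg {α : ℝ} (hα₁ : 1 < α) (hα₂ : α < 2) {s : ℂ} (hs : 0 ≤ s.re) :
    s ^ (α : ℂ) + 1 ≠ 0 := by
  intro h
  have hα0 : (α : ℂ) ≠ 0 := by exact_mod_cast (by linarith : α ≠ 0)
  rcases eq_or_ne s 0 with rfl | h0
  · simp [Complex.zero_cpow hα0] at h
  rw [Complex.cpow_def_of_ne_zero h0, add_eq_zero_iff_eq_neg, ← Complex.exp_pi_mul_I,
    Complex.exp_eq_exp_iff_exists_int] at h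
  obtain ⟨n, hn⟩ := h
  have him := congrArg Complex.im hn
  simp [Complex.log_im] at him
  have harg := Complex.abs_arg_le_of_re_nonneg hs
  rw [abs_le] at harg
  have hpi := Real.pi_pos
  -- Here α arg s = (1 + 2n)π, while |α arg s| ≤ απ/2 < π, so -1 < 1 + 2n < 1, which no integer
  -- satisfies.
  have h1 : (1 + 2 * (n : ℝ)) < 1 := by
    by_contra! hcon
    nlinarith
  have h2 : -1 < (1 + 2 * (n : ℝ)) := by
    by_contra! hcon
    nlinarith
  have h3 : n < 0 := by exact_mod_cast (by linarith : (n : ℝ) < 0)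
  have h4 : -1 < n := by exact_mod_cast (by linarith : (-1 : ℝ) < n)
  omega

theorem eq_I_of_cpow_eq {α : ℝ} (hα₁ : 1 < α) (hα₂ : α < 2) {s : ℂ} (hs : 0 ≤ s.re)
    (h : s ^ (α : ℂ) = Complex.I ^ (α : ℂ)) : s = Complex.I := by
  have hα0 : (α : ℂ) ≠ 0 := by exact_mod_cast (by linarith : α ≠ 0)
  rcases eq_or_ne s 0 with rfl | h0
  · rw [Complex.zero_cpow hα0] at h
    exact absurd h.symm (by simp [Complex.cpow_eq_zero_iff])
  rw [Complex.cpow_def_of_ne_zero h0, Complex.cpow_def_of_ne_zero Complex.I_ne_zero,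
    Complex.exp_eq_exp_iff_exists_int] at h
  obtain ⟨n, hn⟩ := h
  have him := congrArg Complex.im hn
  simp [Complex.log_im] at him
  have harg := Complex.abs_arg_le_of_re_nonneg hs
  rw [abs_le] at harg
  have hpi := Real.pi_pos
  -- Here α arg s = απ/2 + 2πn with |arg s| ≤ π/2, so -απ ≤ 2πn ≤ 0; α < 2 leaves only n = 0.
  have h1 : (n : ℝ) ≤ 0 := by
    by_contra! hcon
    nlinarith
  have h2 : -1 < (n : ℝ) := by
    by_contra! hcon
    nlinarith
  have h3 : n ≤ 0 := by exact_mod_cast h1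
  have h4 : -1 < n := by exact_mod_cast h2
  obtain rfl : n = 0 := by omega
  simp only [Int.cast_zero, zero_mul, add_zero] at hn
  have := mul_right_cancel₀ hα0 hn
  rw [← Complex.exp_log h0, this, Complex.exp_log Complex.I_ne_zero]

/-- `E_α(-t ^ α) → 0`. -/
theorem tendsto_fracSeries_neg_one {α : ℝ} (hα₁ : 1 < α) (hα₂ : α < 2) :
    Tendsto (fracSeries α fun k => (-1 : ℂ) ^ k) atTop (𝓝 0) := by
  have h := tendsto_fracSeries_sub_exp (p := 0) (c := -1) hα₁ (by simp)
    (G := fun s => s ^ (α - 1 : ℂ) / (s ^ (α : ℂ) - (-1)) - 0 / (s - Complex.I) - (1 - 0) / (s + 1))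
    ?_ ?_ (fun s _ _ => rfl)
  · simpa using h
  · intro s hs
    simp only [zero_div, sub_zero, sub_neg_eq_add]
    have e : (α - 1 : ℂ) = ((α - 1 : ℝ) : ℂ) := by push_cast; rfl
    rw [e]
    refine ((continuousWithinAt_cpow_const_of_re_nonneg (by linarith) hs _).div
      ((continuousWithinAt_cpow_const_of_re_nonneg (by linarith) hs _).add
        continuousWithinAt_const) (cpow_ne_neg_one_of_re_nonneg hα₁ hα₂ hs)).sub
      (continuousWithinAt_const.div (continuousWithinAt_id.add continuousWithinAt_const) ?_)
    intro h0
    have := congrArg Complex.re h0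
    simp at this
    have hs' : 0 ≤ s.re := hs
    linarith
  · intro s hs
    have hs' : 0 < s.re := hs
    simp only [zero_div, sub_zero, sub_neg_eq_add]
    refine DifferentiableAt.differentiableWithinAt ?_
    have hslit : s ∈ Complex.slitPlane := Or.inl hs'
    refine ((differentiableAt_id.cpow_const hslit).div
      ((differentiableAt_id.cpow_const hslit).add_const 1)
      (cpow_ne_neg_one_of_re_nonneg hα₁ hα₂ hs'.le)).sub
      ((differentiableAt_const _).div (differentiableAt_id.add_const 1) ?_)
    intro h0
    have := congrArg Complex.re h0
    simp at this
    linarith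

/-- `E_α(i ^ α t ^ α) = α⁻¹ exp (i t) + o(1)`. -/
theorem tendsto_fracSeries_I_sub_exp {α : ℝ} (hα₁ : 1 < α) (hα₂ : α < 2) :
    Tendsto (fun t : ℝ => fracSeries α (fun k => (Complex.I ^ (α : ℂ)) ^ k) t -
      1 / α * Complex.exp (Complex.I * t)) atTop (𝓝 0) := by
  have hα0 : (α : ℂ) ≠ 0 := by exact_mod_cast (by linarith : α ≠ 0)
  have hI : Complex.I ∈ Complex.slitPlane := by simp [Complex.mem_slitPlane_iff]
  have hnhds : Complex.slitPlane ∈ 𝓝 Complex.I := Complex.isOpen_slitPlane.mem_nhds hI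
  set q : ℂ → ℂ := fun s => s ^ (α : ℂ) with hq
  -- Dividing out the simple zero of s^α - i^α at i turns the transform into Q(s)/(s - i) with Q(i)
  -- = 1/α. Subtracting the polar part leaves the divided difference of Q at i, regular there.
  set D : ℂ → ℂ := dslope q Complex.I with hD
  set Q : ℂ → ℂ := fun s => s ^ (α - 1 : ℂ) / D s with hQ
  have e : (α - 1 : ℂ) = ((α - 1 : ℝ) : ℂ) := by push_cast; rfl
  have hqd : DifferentiableOn ℂ q Complex.slitPlane := fun s hs =>
    (differentiableAt_id.cpow_const hs).differentiableWithinAt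
  have hDd : DifferentiableOn ℂ D Complex.slitPlane :=
    (Complex.differentiableOn_dslope hnhds).2 hqd
  have hDI : D Complex.I = α * Complex.I ^ (α - 1 : ℂ) := by
    rw [hD, dslope_same]
    have := (hasDerivAt_id Complex.I).cpow_const (c := (α : ℂ)) hI
    simpa using this.deriv
  have hIne : Complex.I ^ (α - 1 : ℂ) ≠ 0 := by simp [Complex.cpow_eq_zero_iff]
  have hDne : ∀ s, s ≠ Complex.I → D s = (s ^ (α : ℂ) - Complex.I ^ (α : ℂ)) / (s - Complex.I) := by
    intro s hs
    rw [hD, dslope_of_ne _ hs, slope_def_field]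
  have hD0 : ∀ s : ℂ, 0 ≤ s.re → D s ≠ 0 := by
    intro s hs
    rcases eq_or_ne s Complex.I with rfl | h
    · rw [hDI]; exact mul_ne_zero hα0 hIne
    · rw [hDne s h]
      exact div_ne_zero (fun h0 => h (eq_I_of_cpow_eq hα₁ hα₂ hs (sub_eq_zero.1 h0)))
        (sub_ne_zero.2 h)
  have hQd : ∀ s : ℂ, 0 ≤ s.re → s ≠ 0 → DifferentiableAt ℂ Q s := by
    intro s hs h0
    have hsl := mem_slitPlane_of_re_nonneg hs h0
    exact (differentiableAt_id.cpow_const hsl).div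
      (hDd.differentiableAt (Complex.isOpen_slitPlane.mem_nhds hsl)) (hD0 s hs)
  have hQI : Q Complex.I = 1 / α := by
    simp only [hQ, hDI]
    field_simp
  have hs1 : ∀ s : ℂ, 0 ≤ s.re → s + 1 ≠ 0 := by
    intro s hs h0
    have := congrArg Complex.re h0
    simp at this
    linarith
  have hnorm : ‖Complex.I ^ (α : ℂ)‖ ≤ 1 := by
    rw [Complex.norm_cpow_real, Complex.norm_I, Real.one_rpow]
  refine tendsto_fracSeries_sub_exp hα₁ hnorm
    (G := fun s => dslope Q Complex.I s - (1 - 1 / α) / (s + 1)) ?_ ?_ ?_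
  · intro s hs
    refine ContinuousWithinAt.sub ?_ (continuousWithinAt_const.div
      (continuousWithinAt_id.add continuousWithinAt_const) (hs1 s hs))
    rcases eq_or_ne s Complex.I with rfl | h
    · exact (continuousAt_dslope_same.2 (hQd _ (by simp) Complex.I_ne_zero)).continuousWithinAt
    -- This case includes the branch point s = 0, where only continuity of the powers is available.
    · rw [continuousWithinAt_dslope_of_ne h]
      have h1 : ContinuousWithinAt D {s | 0 ≤ s.re} s := by
        rw [hD, continuousWithinAt_dslope_of_ne h]
        exact continuousWithinAt_cpow_const_of_re_nonneg (by linarith) hs _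
      rw [hQ, e]
      exact (continuousWithinAt_cpow_const_of_re_nonneg (by linarith) hs _).div h1 (hD0 s hs)
  · intro s hs
    have hs' : 0 < s.re := hs
    refine DifferentiableWithinAt.sub ?_ ((differentiableWithinAt_const _).div
      (differentiableWithinAt_id.add_const 1) (hs1 s hs'.le))
    rw [differentiableWithinAt_dslope_of_ne (by rintro rfl; simp at hs')]
    exact (hQd s hs'.le (by rintro rfl; simp at hs')).differentiableWithinAt
  · intro s hs h
    have h1 : s ^ (α : ℂ) - Complex.I ^ (α : ℂ) ≠ 0 :=
      fun h0 => h (eq_I_of_cpow_eq hα₁ hα₂ hs (sub_eq_zero.1 h0))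
    have h2 := sub_ne_zero.2 h
    rw [dslope_of_ne _ h, slope_def_field, hQI]
    simp only [hQ, hDne s h]
    field_simp

end Asymptotics

/-! ### Decay of E_α on the negative axis, uniform with a weight -/

section RealMittagLeffler

/-- The real Mittag-Leffler function. -/
noncomputable def realMittagLeffler (α x : ℝ) : ℝ := ∑' k : ℕ, x ^ k / Real.Gamma (α * k + 1)

theorem continuous_realMittagLeffler {α : ℝ} (hα : 1 ≤ α) : Continuous (realMittagLeffler α) := by
  refine continuous_iff_continuousAt.2 fun x => ?_
  have h : ContinuousOn (realMittagLeffler α) (Icc (-(|x| + 1)) (|x| + 1)) := by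
    refine continuousOn_tsum (fun k => by fun_prop)
      (summable_pow_div_Gamma hα (|x| + 1)) (fun k y hy => ?_)
    have hΓ := Gamma_mul_add_one_pos hα k
    rw [norm_div, norm_pow, Real.norm_eq_abs, Real.norm_of_nonneg hΓ.le,
      abs_of_nonneg (show 0 ≤ |x| + 1 by positivity)]
    gcongr
    exact abs_le.2 hy
  exact h.continuousAt (Icc_mem_nhds (by linarith [neg_abs_le x]) (by linarith [le_abs_self x]))

theorem ofReal_realMittagLeffler_neg_rpow (α t : ℝ) :
    ((realMittagLeffler α (-(t ^ α)) : ℝ) : ℂ) = fracSeries α (fun k => (-1 : ℂ) ^ k) t := by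
  rw [realMittagLeffler, fracSeries, Complex.ofReal_tsum]
  refine tsum_congr fun k => ?_
  rw [neg_pow, Complex.real_smul]
  push_cast
  ring

theorem tendsto_realMittagLeffler_neg {α : ℝ} (hα₁ : 1 < α) (hα₂ : α < 2) :
    Tendsto (fun x => realMittagLeffler α (-x)) atTop (𝓝 0) := by
  have h : Tendsto (fun t : ℝ => realMittagLeffler α (-(t ^ α))) atTop (𝓝 0) := by
    rw [tendsto_zero_iff_norm_tendsto_zero]
    have := (tendsto_fracSeries_neg_one hα₁ hα₂).norm
    simpa [← ofReal_realMittagLeffler_neg_rpow] using this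
  refine (h.comp (tendsto_rpow_atTop (show 0 < 1 / α by positivity))).congr' ?_
  filter_upwards [eventually_ge_atTop 0] with x hx
  have hα0 : α ≠ 0 := by linarith
  simp only [Function.comp_apply]
  rw [← Real.rpow_mul hx, one_div_mul_cancel hα0, Real.rpow_one]

theorem exists_forall_realMittagLeffler_mul_min_le {α : ℝ} (hα₁ : 1 < α) (hα₂ : α < 2) {η : ℝ}
    (hη : 0 < η) :
    ∀ᶠ t : ℝ in atTop, ∀ x : ℝ, 0 ≤ x → |realMittagLeffler α (-(t ^ α * x))| * min 1 x ≤ η := by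
  have hlim := tendsto_realMittagLeffler_neg hα₁ hα₂
  have hc : Continuous fun x => realMittagLeffler α (-x) :=
    (continuous_realMittagLeffler hα₁.le).comp continuous_neg
  have hsmall : ∀ᶠ x in atTop, |realMittagLeffler α (-x)| < η := by
    simpa using (Metric.tendsto_nhds.1 hlim η hη)
  obtain ⟨N, hN⟩ := eventually_atTop.1 hsmall
  obtain ⟨C, hC⟩ := (isCompact_Icc (a := (0 : ℝ)) (b := |N|)).exists_bound_of_continuousOn
    hc.continuousOn
  have hbound : ∀ x, 0 ≤ x → |realMittagLeffler α (-x)| ≤ max C η := by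
    intro x hx
    rcases le_total x |N| with h | h
    · exact (hC x ⟨hx, h⟩).trans (le_max_left _ _)
    · exact (hN x ((le_abs_self N).trans h)).le.trans (le_max_right _ _)
  set K := max C η with hK
  have hK0 : 0 < K := hη.trans_le (le_max_right _ _)
  -- Split at x = η/K. Below it the weight is at most η/K and |E_α| ≤ K; above it t^α x ≥ N for
  -- large t, so |E_α| < η.
  have hδ : 0 < η / K := by positivity
  have ht : Tendsto (fun t : ℝ => t ^ α * (η / K)) atTop atTop :=
    (tendsto_rpow_atTop (by linarith)).atTop_mul_const hδ
  filter_upwards [ht.eventually_ge_atTop N, eventually_ge_atTop 0] with t htN ht0 x hx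
  have htα : 0 ≤ t ^ α := Real.rpow_nonneg ht0 _
  rcases le_total x (η / K) with h | h
  · calc _ ≤ K * (η / K) := by
          gcongr
          · exact hbound _ (by positivity)
          · exact (min_le_right _ _).trans h
      _ = η := by field_simp
  · calc _ ≤ η * 1 := by
          gcongr
          · exact (hN _ (htN.trans (by gcongr))).le
          · exact min_le_left _ _
      _ = η := mul_one η

end RealMittagLeffler

/-! ### Solution of the Volterra equation with a bounded operator -/

section VolterraSolution

theorem eq_fracSeries_of_volterra {E : Type*} [NormedAddCommGroup E] [NormedSpace ℝ E]
    [CompleteSpace E] {α : ℝ} (hα : 1 < α) (L : E →L[ℝ] E) {z : ℝ → E}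
    (hz : ContinuousOn z (Ici 0)) {z₀ : E}
    (h : ∀ t, 0 ≤ t → z t = z₀ + rlIntegral α (fun s => L (z s)) t) {t : ℝ} (ht : 0 ≤ t) :
    z t = fracSeries α (fun k => (L ^ k) z₀) t := by
  have hv : ∀ k : ℕ, ‖(L ^ k) z₀‖ ≤ ‖z₀‖ * ‖L‖ ^ k := by
    intro k
    induction k with
    | zero => simp
    | succ k ih =>
      rw [pow_succ']
      calc ‖L ((L ^ k) z₀)‖ ≤ ‖L‖ * (‖z₀‖ * ‖L‖ ^ k) := (L.le_opNorm _).trans (by gcongr)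
        _ = _ := by ring
  have hV := continuousOn_fracSeries hα.le hv
  set V := fracSeries α (fun k => (L ^ k) z₀) with hVdef
  have hcont : ContinuousOn (fun s => z s - V s) (Ici 0) := hz.sub hV
  have hLV : ∀ s, 0 ≤ s → fracSeries α (fun k => (L ^ (k + 1)) z₀) s = L (V s) := by
    intro s hs
    rw [hVdef, fracSeries, fracSeries, L.map_tsum (summable_fracSeries hα.le hv hs)]
    refine tsum_congr fun k => ?_
    rw [map_smul, pow_succ']
    rfl
  -- The series solves the same equation, so the difference solves the homogeneous one and vanishes
  -- by uniqueness.
  have key := eq_zero_of_eq_rlIntegral hα L hcont (fun s hs => ?_) ht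
  · exact sub_eq_zero.1 key
  · have h1 := fracSeries_eq_add_rlIntegral hα hv hs
    rw [rlIntegral_congr hs (fun r hr => hLV r hr.1)] at h1
    have h2 := rlIntegral_add (a := α) (by linarith) hs
      ((L.continuous.comp_continuousOn hcont).mono Icc_subset_Ici_self)
      ((L.continuous.comp_continuousOn hV).mono Icc_subset_Ici_self)
    simp only [Function.comp_def, map_sub, sub_add_cancel] at h2
    rw [h s hs, hVdef, h1]
    simp only [map_sub]
    rw [← hVdef, h2]
    simp

end VolterraSolution

/-! ### Mittag-Leffler functions of a selfadjoint operator -/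

section FunctionalCalculus

variable {H : Type*} [NormedAddCommGroup H] [InnerProductSpace ℂ H] [CompleteSpace H]

theorem fracSeries_pow_cfc {α : ℝ} (hα : 1 ≤ α) (T : H →L[ℂ] H) (hT : IsSelfAdjoint T)
    {χ : ℝ → ℝ} (hχ : Continuous χ) {t : ℝ} (ht : 0 ≤ t) :
    fracSeries α (fun k => (-cfc χ T) ^ k) t =
      cfc (fun x => realMittagLeffler α (-(t ^ α * χ x))) T := by
  have htα : 0 ≤ t ^ α := Real.rpow_nonneg ht _
  obtain ⟨C, hC⟩ := (ContinuousFunctionalCalculus.isCompact_spectrum (R := ℝ)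
    T).exists_bound_of_continuousOn hχ.continuousOn
  have hv : ∀ k : ℕ, ‖(-cfc χ T) ^ k‖ ≤ (max 1 ‖(1 : H →L[ℂ] H)‖) * ‖-cfc χ T‖ ^ k := by
    intro k
    rcases Nat.eq_zero_or_pos k with rfl | hk
    · simp
    · calc _ ≤ 1 * ‖-cfc χ T‖ ^ k := by rw [one_mul]; exact norm_pow_le' _ hk
        _ ≤ _ := by gcongr; exact le_max_left _ _
  have h1 := (summable_fracSeries hα hv ht).hasSum.tendsto_sum_nat
  -- The scalar partial sums converge uniformly on the compact spectrum, so their functional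
  -- calculus converges to that of the limit; the operator partial sums are the same.
  have hunif : TendstoUniformlyOn
      (fun (n : ℕ) (x : ℝ) => ∑ k ∈ Finset.range n,
        (t ^ α) ^ k / Real.Gamma (α * k + 1) * (-χ x) ^ k)
      (fun x => realMittagLeffler α (-(t ^ α * χ x))) atTop (spectrum ℝ T) := by
    have h := tendstoUniformlyOn_tsum_nat (summable_pow_div_Gamma hα (t ^ α * C))
      (f := fun (k : ℕ) (x : ℝ) => (-(t ^ α * χ x)) ^ k / Real.Gamma (α * k + 1))
      (s := spectrum ℝ T) (fun k x hx => by
        have hΓ := Gamma_mul_add_one_pos hα k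
        rw [norm_div, norm_pow, norm_neg, norm_mul, Real.norm_of_nonneg hΓ.le,
          Real.norm_of_nonneg htα, abs_mul, abs_of_nonneg htα]
        gcongr
        exact (hC x hx).trans (le_abs_self C))
    refine h.congr (Eventually.of_forall fun n x _ => ?_)
    refine Finset.sum_congr rfl fun k _ => ?_
    rw [← mul_neg, mul_pow]
    ring
  have h2 := tendsto_cfc_fun (a := T) hunif (Eventually.of_forall fun n => by fun_prop)
  refine tendsto_nhds_unique h1 (h2.congr fun n => ?_)
  rw [← Finset.sum_fn, cfc_sum (fun (k : ℕ) (x : ℝ) => (t ^ α) ^ k / Real.Gamma (α * k + 1) * (-χ x) ^ k) T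
    (Finset.range n) (fun k _ => by fun_prop)]
  refine Finset.sum_congr rfl fun k _ => ?_
  rw [cfc_const_mul _ _ T (by fun_prop), cfc_pow _ _ T (by fun_prop), cfc_neg]

end FunctionalCalculus

/-! ### Spectral cutoff by functions of the resolvent -/

section Cutoff

/-- The inverse, truncated at `ε`. -/
noncomputable def truncInv (ε x : ℝ) : ℝ := (max x ε)⁻¹

theorem continuous_truncInv {ε : ℝ} (hε : 0 < ε) : Continuous (truncInv ε) :=
  (continuous_id.max continuous_const).inv₀ fun _ => (hε.trans_le (le_max_right _ _)).ne'

theorem truncInv_mul_eq {ε : ℝ} (hε : 0 < ε) (x : ℝ) :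
    (1 - ε * truncInv ε x) * (1 - x) = (truncInv ε x - 1) * ((1 - ε * truncInv ε x) * x) := by
  rw [truncInv]
  rcases le_total x ε with h | h
  · rw [max_eq_right h, mul_inv_cancel₀ hε.ne']
    ring
  · have hx : x ≠ 0 := (hε.trans_le h).ne'
    rw [max_eq_left h]
    field_simp

theorem truncInv_bounds {ε x : ℝ} (hε : 0 < ε) (hε1 : ε ≤ 1) (hx : x ∈ Icc (0 : ℝ) 1) :
    1 ≤ truncInv ε x ∧ ε * truncInv ε x ≤ 1 ∧ 0 ≤ ε * truncInv ε x ∧ truncInv ε x * x ≤ 1 := by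
  have h0 : 0 < max x ε := hε.trans_le (le_max_right _ _)
  refine ⟨(one_le_inv₀ h0).2 (max_le hx.2 hε1), ?_, ?_, ?_⟩
  · rw [truncInv, ← div_eq_mul_inv, div_le_one h0]; exact le_max_right _ _
  · rw [truncInv]; positivity
  · rw [truncInv, inv_mul_le_one₀ h0]; exact le_max_left _ _

variable {H : Type*} [NormedAddCommGroup H] [InnerProductSpace ℂ H] [CompleteSpace H]

/-- The operator `1 - ε max(T, ε)⁻¹`, which approximates the identity on the range of `T`. -/
noncomputable def cutoff (T : H →L[ℂ] H) (ε : ℝ) : H →L[ℂ] H :=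
  cfc (fun x => 1 - ε * truncInv ε x) T

/-- The bounded operator `max(T, ε)⁻¹ - 1`. -/
noncomputable def truncGenerator (T : H →L[ℂ] H) (ε : ℝ) : H →L[ℂ] H :=
  cfc (fun x => truncInv ε x - 1) T

theorem cutoff_mul_one_sub {T : H →L[ℂ] H} (hT : IsSelfAdjoint T) {ε : ℝ} (hε : 0 < ε) :
    cutoff T ε * (1 - T) = truncGenerator T ε * (cutoff T ε * T) := by
  have hc := continuous_truncInv hε
  have h1 : (1 - T) = cfc (fun x : ℝ => 1 - x) T := by
    rw [cfc_sub _ _ T (by fun_prop) (by fun_prop), cfc_const_one ℝ T, cfc_id' ℝ T]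
  have h2 : cutoff T ε * T = cfc (fun x : ℝ => (1 - ε * truncInv ε x) * x) T := by
    rw [cfc_mul _ _ T (by fun_prop) (by fun_prop), cfc_id' ℝ T, cutoff]
  rw [h1, h2, cutoff, truncGenerator, ← cfc_mul _ _ T (by fun_prop) (by fun_prop),
    ← cfc_mul _ _ T (by fun_prop) (by fun_prop)]
  exact cfc_congr fun x _ => truncInv_mul_eq hε x

/-- The difference is the function ε x/max(x, ε) of T, which is at most ε. The factor T is
essential: the cutoffs approximate the identity with a rate only on the range of T, that is on D(A).
-/
theorem norm_sub_cutoff_le {T : H →L[ℂ] H} (hT : IsSelfAdjoint T)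
    (hsp : spectrum ℝ T ⊆ Icc 0 1) {ε : ℝ} (hε : 0 < ε) (hε1 : ε ≤ 1) :
    ‖T - cutoff T ε * T‖ ≤ ε := by
  have hc := continuous_truncInv hε
  have h2 : T - cutoff T ε * T = cfc (fun x : ℝ => x - (1 - ε * truncInv ε x) * x) T := by
    rw [cfc_sub _ _ T (by fun_prop) (by fun_prop), cfc_mul _ _ T (by fun_prop) (by fun_prop),
      cfc_id' ℝ T, cutoff]
  rw [h2]
  refine norm_cfc_le hε.le fun x hx => ?_
  have hx' := hsp hx
  obtain ⟨b1, b2, b3, b4⟩ := truncInv_bounds hε hε1 hx'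
  have : x - (1 - ε * truncInv ε x) * x = ε * (truncInv ε x * x) := by ring
  rw [this, Real.norm_of_nonneg (by have := hx'.1; positivity)]
  nlinarith

/-- With λ = `truncInv ε x - 1`, the factor (1 - ε/max(x, ε))(1 - x) is at most 1 and, by
`truncInv_mul_eq`, at most λ. It thus supplies the weight min(1, λ), with a bound free of ε. -/
theorem norm_cfc_mul_cutoff_le {T : H →L[ℂ] H} (hT : IsSelfAdjoint T)
    (hsp : spectrum ℝ T ⊆ Icc 0 1) {ε : ℝ} (hε : 0 < ε) (hε1 : ε ≤ 1) {h : ℝ → ℝ}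
    (hh : Continuous h) {η : ℝ} (hη : 0 ≤ η) (hb : ∀ x : ℝ, 0 ≤ x → |h x| * min 1 x ≤ η) :
    ‖cfc (fun x => h (truncInv ε x - 1)) T * (cutoff T ε * (1 - T))‖ ≤ η := by
  have hc := continuous_truncInv hε
  have h1 : (1 - T) = cfc (fun x : ℝ => 1 - x) T := by
    rw [cfc_sub _ _ T (by fun_prop) (by fun_prop), cfc_const_one ℝ T, cfc_id' ℝ T]
  rw [h1, cutoff, ← cfc_mul _ _ T (by fun_prop) (by fun_prop),
    ← cfc_mul _ _ T (by fun_prop) (by fun_prop)]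
  refine norm_cfc_le hη fun x hx => ?_
  have hx' := hsp hx
  obtain ⟨b1, b2, b3, b4⟩ := truncInv_bounds hε hε1 hx'
  have hx1 : 0 ≤ 1 - x := by linarith [hx'.2]
  have hφ : 0 ≤ 1 - ε * truncInv ε x := by linarith
  refine le_trans ?_ (hb (truncInv ε x - 1) (by linarith))
  rw [norm_mul, Real.norm_eq_abs]
  gcongr
  rw [Real.norm_of_nonneg (mul_nonneg hφ hx1)]
  refine le_min (mul_le_one₀ (by linarith) hx1 (by linarith [hx'.1])) ?_
  rw [truncInv_mul_eq hε]
  have h3 : (1 - ε * truncInv ε x) * x ≤ 1 := mul_le_one₀ (by linarith) hx'.1 hx'.2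
  exact mul_le_of_le_one_right (by linarith) h3

end Cutoff

/-! ### Decay of the difference from the steady state -/

section Decay

theorem mlOscillation_eq_fracSeries (α ω t : ℝ) :
    mlOscillation α ω t = fracSeries α (fun k => iOmegaPow α ω ^ k) t := by
  rw [mlOscillation, mittagLeffler, fracSeries]
  refine tsum_congr fun k => ?_
  rw [mul_pow, Complex.real_smul]
  push_cast
  ring

theorem continuousOn_mlOscillation {α : ℝ} (hα : 1 ≤ α) (ω : ℝ) :
    ContinuousOn (mlOscillation α ω) (Ici 0) :=
  (continuousOn_fracSeries hα (v := fun k => iOmegaPow α ω ^ k) (C := 1) (ρ := ‖iOmegaPow α ω‖)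
    (fun k => by simp)).congr fun t _ => mlOscillation_eq_fracSeries α ω t

theorem mlOscillation_volterra {α : ℝ} (hα : 1 < α) (ω : ℝ) {t : ℝ} (ht : 0 ≤ t) :
    mlOscillation α ω t =
      1 + rlIntegral α (fun s => iOmegaPow α ω * mlOscillation α ω s) t := by
  rw [mlOscillation_eq_fracSeries, fracSeries_eq_add_rlIntegral hα (C := 1)
    (ρ := ‖iOmegaPow α ω‖) (fun k => by simp) ht, pow_zero]
  congr 1
  refine rlIntegral_congr ht fun s _ => ?_
  simp only [mlOscillation_eq_fracSeries, fracSeries]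
  rw [← tsum_mul_left]
  refine tsum_congr fun k => ?_
  rw [pow_succ', mul_smul_comm]

variable {H : Type*} [NormedAddCommGroup H] [InnerProductSpace ℂ H] [CompleteSpace H]

theorem fracSeries_pow_apply {α : ℝ} (hα : 1 ≤ α) (B : H →L[ℂ] H) (x : H) {t : ℝ} (ht : 0 ≤ t) :
    fracSeries α (fun k => (B.restrictScalars ℝ ^ k) x) t = fracSeries α (fun k => B ^ k) t x := by
  have hv : ∀ k : ℕ, ‖B ^ k‖ ≤ (max 1 ‖(1 : H →L[ℂ] H)‖) * ‖B‖ ^ k := by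
    intro k
    rcases Nat.eq_zero_or_pos k with rfl | hk
    · simp
    · calc _ ≤ 1 * ‖B‖ ^ k := by rw [one_mul]; exact norm_pow_le' _ hk
        _ ≤ _ := by gcongr; exact le_max_left _ _
  have hpow : ∀ k : ℕ, (B.restrictScalars ℝ ^ k) x = (B ^ k) x := by
    intro k
    induction k with
    | zero => rfl
    | succ k ih =>
      rw [pow_succ', pow_succ', mul_apply_eq_comp, ih]
      rfl
  have h := (ContinuousLinearMap.apply ℂ H x).hasSum (summable_fracSeries hα hv ht).hasSum
  rw [fracSeries, fracSeries]
  refine Eq.trans (tsum_congr fun k => ?_) h.tsum_eq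
  rw [hpow]
  rfl

/-- The difference between the steady state and a strong solution, compressed by an operator which
intertwines `A` with a bounded operator `B`, is given by the Mittag-Leffler function of `-B`. -/
theorem IsStrongSolution.compression_eq {A : H →ₗ.[ℂ] H} {α ω : ℝ} (hα₁ : 1 < α) (hα₂ : α < 2)
    {f₀ : H} {u : ℝ → H} (hu : IsStrongSolution A α (fun t => mlOscillation α ω t • f₀) u)
    {r : A.domain} (hr : A r + iOmegaPow α ω • (r : H) = f₀)
    {P B : H →L[ℂ] H} (hPB : ∀ x : A.domain, P (A x) = B (P x)) {t : ℝ} (ht : 0 ≤ t) :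
    P (mlOscillation α ω t • (r : H) - u t) = fracSeries α (fun k => (-B) ^ k) t (P r) := by
  set c := iOmegaPow α ω
  have hE := continuousOn_mlOscillation hα₁.le ω
  have huc := hu.contDiffOn.continuousOn
  have hw : ContinuousOn (fun t => P (mlOscillation α ω t • (r : H) - u t)) (Ici 0) :=
    P.continuous.comp_continuousOn ((hE.smul continuousOn_const).sub huc)
  rw [← fracSeries_pow_apply hα₁.le (-B) (P r) ht]
  refine eq_fracSeries_of_volterra hα₁ ((-B).restrictScalars ℝ) hw (fun s hs => ?_) ht
  have hY := hu.volterra hα₁ hα₂ (hE.smul continuousOn_const) hPB hs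
  have hsum := rlIntegral_add (a := α) (by linarith) hs
    (f := fun s => (-B) (P (mlOscillation α ω s • (r : H) - u s)))
    (g := fun s => P (mlOscillation α ω s • f₀) - B (P (u s)))
    (((-B).continuous.comp_continuousOn hw).mono Icc_subset_Ici_self)
    (((P.continuous.comp_continuousOn (hE.smul continuousOn_const)).sub
      (B.continuous.comp_continuousOn (P.continuous.comp_continuousOn huc))).mono
        Icc_subset_Ici_self)
  rw [← hY] at hsum
  -- Since f₀ = A r + c r, the sum of both integrands collapses to c E(s) P r, whose J^α is (E - 1)
  -- P r by the scalar Volterra equation.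
  have hX : ∀ s, (-B) (P (mlOscillation α ω s • (r : H) - u s)) +
      (P (mlOscillation α ω s • f₀) - B (P (u s))) =
      ((ContinuousLinearMap.toSpanSingleton ℂ (P r)).restrictScalars ℝ)
        (c * mlOscillation α ω s) := by
    intro s
    rw [ContinuousLinearMap.coe_restrictScalars', ContinuousLinearMap.toSpanSingleton_apply, ← hr]
    simp only [neg_apply, map_sub, map_smul, map_add, hPB]
    module
  simp only [hX] at hsum
  rw [ContinuousLinearMap.rlIntegral_comp (f := fun s => c * mlOscillation α ω s) _
    (by linarith) hs
    ((continuousOn_const.mul hE).mono Icc_subset_Ici_self)] at hsum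
  have hEv := mlOscillation_volterra hα₁ ω hs
  rw [← sub_eq_iff_eq_add'] at hEv
  rw [← hEv, ContinuousLinearMap.coe_restrictScalars',
    ContinuousLinearMap.toSpanSingleton_apply, sub_smul, one_smul] at hsum
  change _ = P r + rlIntegral α (fun s => (-B) (P (mlOscillation α ω s • (r : H) - u s))) s
  rw [eq_sub_of_add_eq hsum.symm, map_sub, map_smul]
  abel

/-- A strong solution is asymptotic to the steady state `mlOscillation α ω t • r`. -/
theorem IsStrongSolution.tendsto_sub {A : H →ₗ.[ℂ] H} {α ω : ℝ} (hα₁ : 1 < α) (hα₂ : α < 2)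
    {f₀ : H} {u : ℝ → H} (hu : IsStrongSolution A α (fun t => mlOscillation α ω t • f₀) u)
    {r : A.domain} (hr : A r + iOmegaPow α ω • (r : H) = f₀)
    {T : H →L[ℂ] H} (hT : IsSelfAdjoint T) (hsp : spectrum ℝ T ⊆ Icc 0 1)
    (hTA : ∀ x : A.domain, T (A x + x) = x) {y : H} (hy : (r : H) = y - T y) :
    Tendsto (fun t => mlOscillation α ω t • (r : H) - u t) atTop (𝓝 0) := by
  have hbound : ∀ η : ℝ, 0 < η → ∀ᶠ t in atTop,
      ‖mlOscillation α ω t • (r : H) - u t‖ ≤ η * ‖y‖ := by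
    intro η hη
    filter_upwards [exists_forall_realMittagLeffler_mul_min_le hα₁ hα₂ hη, eventually_ge_atTop 0]
      with t htη ht
    set w := mlOscillation α ω t • (r : H) - u t with hw
    have hwdom : w ∈ A.domain :=
      A.domain.sub_mem (A.domain.smul_mem _ r.2) (hu.mem_domain t ht)
    have hwT : T (A ⟨w, hwdom⟩ + w) = w := hTA ⟨w, hwdom⟩
    set z := A ⟨w, hwdom⟩ + w
    -- Here t is fixed and w = T z, so the cutoff costs ε‖z‖; z may depend on t because ε → 0 is
    -- taken before t → ∞.
    have hε : ∀ ε : ℝ, 0 < ε → ε ≤ 1 → ‖w‖ ≤ η * ‖y‖ + ε * ‖z‖ := by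
      intro ε hε hε1
      have hcut := cutoff_mul_one_sub hT hε
      have hPB : ∀ x : A.domain, cutoff T ε (A x) = truncGenerator T ε (cutoff T ε x) := by
        intro x
        -- On A x + x the operator T gives x and 1 - T gives A x.
        have h1 := DFunLike.congr_fun hcut (A x + x)
        simp only [mul_apply_eq_comp, sub_apply,
          one_apply_eq_self, hTA, add_sub_cancel_right] at h1
        exact h1
      have hP := hu.compression_eq hα₁ hα₂ hr hPB ht
      have hc := continuous_truncInv hε
      rw [truncGenerator, fracSeries_pow_cfc hα₁.le T hT (by fun_prop) ht] at hP
      have h2 : (r : H) = (1 - T) y := by simp [hy]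
      have h3 := norm_cfc_mul_cutoff_le hT hsp hε hε1
        (h := fun x => realMittagLeffler α (-(t ^ α * x)))
        ((continuous_realMittagLeffler hα₁.le).comp (by fun_prop)) hη.le htη
      have h4 : ‖cutoff T ε w‖ ≤ η * ‖y‖ := by
        rw [hw, hP, h2]
        exact ContinuousLinearMap.le_of_opNorm_le _ h3 y
      have h5 : ‖w - cutoff T ε w‖ ≤ ε * ‖z‖ := by
        have := ContinuousLinearMap.le_of_opNorm_le _ (norm_sub_cutoff_le hT hsp hε hε1) z
        simpa [hwT] using this
      calc ‖w‖ = ‖cutoff T ε w + (w - cutoff T ε w)‖ := by congr 1; abel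
        _ ≤ _ := (norm_add_le _ _).trans (add_le_add h4 h5)
    have hlim : Tendsto (fun ε : ℝ => η * ‖y‖ + ε * ‖z‖) (𝓝[>] 0) (𝓝 (η * ‖y‖)) := by
      have : Continuous fun ε : ℝ => η * ‖y‖ + ε * ‖z‖ := by fun_prop
      have h := this.tendsto 0
      simp only [zero_mul, add_zero] at h
      exact h.mono_left nhdsWithin_le_nhds
    refine ge_of_tendsto hlim ?_
    filter_upwards [Ioc_mem_nhdsGT (show (0 : ℝ) < 1 by norm_num)] with ε h
    exact hε ε h.1 h.2
  rw [Metric.tendsto_nhds]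
  intro δ hδ
  filter_upwards [hbound (δ / (2 * (‖y‖ + 1))) (by positivity)] with t h
  rw [dist_zero_right]
  refine h.trans_lt ?_
  rw [div_mul_eq_mul_div, div_lt_iff₀ (by positivity)]
  nlinarith [norm_nonneg y]

end Decay

/-! ### Resolvents of a nonnegative selfadjoint operator -/

section Resolvent

variable {H : Type*} [NormedAddCommGroup H] [InnerProductSpace ℂ H]

theorem norm_le_norm_map_add {A : H →ₗ.[ℂ] H}
    (hA_nonneg : ∀ x : A.domain, 0 ≤ (inner ℂ (A x) (x : H)).re) (x : A.domain) :
    ‖(x : H)‖ ≤ ‖A x + x‖ := by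
  have h1 : ‖(x : H)‖ ^ 2 ≤ (inner ℂ (A x + x) (x : H)).re := by
    have h : (inner ℂ (x : H) (x : H)).re = ‖(x : H)‖ ^ 2 := inner_self_eq_norm_sq (𝕜 := ℂ) _
    rw [inner_add_left, Complex.add_re, h]
    linarith [hA_nonneg x]
  have h2 : (inner ℂ (A x + x) (x : H)).re ≤ ‖A x + x‖ * ‖(x : H)‖ :=
    (Complex.re_le_norm _).trans (norm_inner_le_norm _ _)
  rcases (norm_nonneg (x : H)).eq_or_lt with h | h
  · rw [← h]; exact norm_nonneg _
  · nlinarith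

variable [CompleteSpace H]

theorem LinearPMap.inner_map_eq_of_isSelfAdjoint {A : H →ₗ.[ℂ] H} (hA : IsSelfAdjoint A)
    (x y : A.domain) : inner ℂ (A x) (y : H) = inner ℂ (x : H) (A y) := by
  have h := LinearPMap.adjoint_isFormalAdjoint hA.dense_domain
  rw [LinearPMap.isSelfAdjoint_def.1 hA] at h
  exact h x y

/-- The domain of A is that of its adjoint, so a weak identity already yields membership; this
serves both as closedness of A and for the orthogonal complement of the range of A + 1. -/
theorem LinearPMap.mem_domain_of_isSelfAdjoint {A : H →ₗ.[ℂ] H} (hA : IsSelfAdjoint A) {y z : H}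
    (h : ∀ x : A.domain, inner ℂ z (x : H) = inner ℂ y (A x)) :
    ∃ hy : y ∈ A.domain, A ⟨y, hy⟩ = z := by
  have hy : y ∈ A.domain := by
    have := LinearPMap.mem_adjoint_domain_of_exists y ⟨z, h⟩
    rwa [LinearPMap.isSelfAdjoint_def.1 hA] at this
  refine ⟨hy, hA.dense_domain.eq_of_inner_left (𝕜 := ℂ) fun x hx => ?_⟩
  exact (LinearPMap.inner_map_eq_of_isSelfAdjoint hA ⟨y, hy⟩ ⟨x, hx⟩).trans (h ⟨x, hx⟩).symm

theorem surjective_map_add {A : H →ₗ.[ℂ] H} (hA : IsSelfAdjoint A)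
    (hA_nonneg : ∀ x : A.domain, 0 ≤ (inner ℂ (A x) (x : H)).re) (y : H) :
    ∃ x : A.domain, A x + x = y := by
  set L : A.domain →ₗ[ℂ] H := A.toFun + A.domain.subtype with hL
  have hLapp : ∀ x : A.domain, L x = A x + x := fun x => rfl
  -- A + 1 is bounded below and A is closed, so the range is closed. A vector orthogonal to it
  -- satisfies A y = -y, hence is 0 by the same lower bound.
  have hclosed : IsClosed (LinearMap.range L : Set H) := by
    rw [← isSeqClosed_iff_isClosed]
    intro v p hv hp
    choose x hx using hv
    have hcau : CauchySeq fun n => (x n : H) := by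
      rw [Metric.cauchySeq_iff']
      intro ε hε
      obtain ⟨N, hN⟩ := Metric.cauchySeq_iff'.1 hp.cauchySeq ε hε
      refine ⟨N, fun n hn => (lt_of_le_of_lt ?_ (hN n hn))⟩
      rw [dist_eq_norm, dist_eq_norm, ← hx, ← hx, ← map_sub, hLapp]
      exact norm_le_norm_map_add hA_nonneg (x n - x N)
    obtain ⟨q, hq⟩ := cauchySeq_tendsto_of_complete hcau
    have hAx : Tendsto (fun n => A (x n)) atTop (𝓝 (p - q)) := by
      refine (hp.sub hq).congr fun n => ?_
      rw [← hx, hLapp, add_sub_cancel_right]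
    obtain ⟨hqd, hAq⟩ := LinearPMap.mem_domain_of_isSelfAdjoint hA (y := q) (z := p - q)
      (fun z => by
        refine tendsto_nhds_unique (hAx.inner tendsto_const_nhds)
          ((hq.inner tendsto_const_nhds).congr fun n => ?_)
        exact (LinearPMap.inner_map_eq_of_isSelfAdjoint hA (x n) z).symm)
    exact ⟨⟨q, hqd⟩, by rw [hLapp, hAq, sub_add_cancel]⟩
  have hbot : (LinearMap.range L)ᗮ = ⊥ := by
    rw [Submodule.eq_bot_iff]
    intro y hy
    rw [Submodule.mem_orthogonal'] at hy
    obtain ⟨hyd, hAy⟩ := LinearPMap.mem_domain_of_isSelfAdjoint hA (y := y) (z := -y) (fun x => by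
      have h := hy _ ⟨x, rfl⟩
      rw [hLapp, inner_add_right] at h
      rw [inner_neg_left]
      exact (eq_neg_of_add_eq_zero_left h).symm)
    have h := norm_le_norm_map_add hA_nonneg ⟨y, hyd⟩
    rw [hAy] at h
    simpa using h
  have : CompleteSpace (LinearMap.range L) := hclosed.completeSpace_coe
  have htop : LinearMap.range L = ⊤ := by
    rw [← Submodule.orthogonal_eq_bot_iff]; exact hbot
  obtain ⟨x, hx⟩ : y ∈ LinearMap.range L := htop ▸ Submodule.mem_top
  exact ⟨x, hx⟩

/-- For a nonnegative selfadjoint `A`, the resolvent `(A + 1)⁻¹` is a selfadjoint operator with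
spectrum in `[0, 1]`. -/
theorem exists_resolvent {A : H →ₗ.[ℂ] H} (hA : IsSelfAdjoint A)
    (hA_nonneg : ∀ x : A.domain, 0 ≤ (inner ℂ (A x) (x : H)).re) :
    ∃ T : H →L[ℂ] H, IsShiftInverse A 1 T ∧ IsSelfAdjoint T ∧ spectrum ℝ T ⊆ Icc 0 1 := by
  choose S hS using surjective_map_add hA hA_nonneg
  have hinj : ∀ x y : A.domain, A x + x = A y + y → x = y := by
    intro x y h
    have h1 := norm_le_norm_map_add hA_nonneg (x - y)
    have h2 : A (x - y) + ((x - y : A.domain) : H) = 0 := by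
      rw [LinearPMap.map_sub, Submodule.coe_sub, sub_add_sub_comm, h, sub_self]
    rw [h2, norm_zero] at h1
    exact sub_eq_zero.1 (Subtype.ext (norm_le_zero_iff.1 h1))
  set T₀ : H →ₗ[ℂ] H :=
    { toFun := fun y => S y
      map_add' := fun y z => by
        rw [← Submodule.coe_add]
        congr 1
        apply hinj
        rw [hS, LinearPMap.map_add, Submodule.coe_add, add_add_add_comm, hS, hS]
      map_smul' := fun a y => by
        rw [RingHom.id_apply, ← Submodule.coe_smul]
        congr 1
        apply hinj
        rw [hS, LinearPMap.map_smul, Submodule.coe_smul, ← smul_add, hS] } with hT₀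
  set T : H →L[ℂ] H := T₀.mkContinuous 1 (fun y => by
    rw [one_mul]
    exact (norm_le_norm_map_add hA_nonneg (S y)).trans_eq (by rw [hS])) with hT
  have hTS : ∀ y, T y = S y := fun y => rfl
  have hinner : ∀ x y : H, inner ℂ (T x) y = inner ℂ (A (S x)) (S y : H) + inner ℂ (S x : H) (S y) := by
    intro x y
    conv_lhs => rw [← hS y]
    rw [inner_add_right, hTS, LinearPMap.inner_map_eq_of_isSelfAdjoint hA]
  have hsymm : (T : H →ₗ[ℂ] H).IsSymmetric := by
    intro x y
    change inner ℂ (T x) y = inner ℂ x (T y)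
    rw [hinner, ← inner_conj_symm x, hinner, map_add, inner_conj_symm, inner_conj_symm,
      LinearPMap.inner_map_eq_of_isSelfAdjoint hA]
  have hpos : T.IsPositive := by
    refine ⟨hsymm, fun x => ?_⟩
    change 0 ≤ (inner ℂ (T x) x).re
    have h : (inner ℂ (S x : H) (S x : H)).re = ‖(S x : H)‖ ^ 2 :=
      inner_self_eq_norm_sq (𝕜 := ℂ) _
    rw [hinner, Complex.add_re, h]
    have := hA_nonneg (S x)
    positivity
  have hnonneg : 0 ≤ T := (ContinuousLinearMap.nonneg_iff_isPositive T).2 hpos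
  have hnorm : ‖T‖ ≤ 1 := T₀.mkContinuous_norm_le zero_le_one _
  refine ⟨T, ⟨fun y => (S y).2, fun y => ?_, fun x => ?_⟩, hpos.isSelfAdjoint, fun x hx => ?_⟩
  · rw [one_smul]; exact hS y
  · rw [one_smul, hTS]
    congr 1
    exact hinj _ _ (hS _)
  · refine ⟨spectrum_nonneg_of_nonneg hnonneg hx, ?_⟩
    cases subsingleton_or_nontrivial H
    · simp at hx
    · exact (le_abs_self x).trans ((spectrum.norm_le_norm_of_mem hx).trans hnorm)

/-- Non-real shifts of `A` are inverted by functions of the resolvent `T = (A + 1)⁻¹`. -/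
theorem exists_isShiftInverse_of_im_ne_zero {A : H →ₗ.[ℂ] H} {T : H →L[ℂ] H}
    (hT : IsShiftInverse A 1 T) (hTsa : IsSelfAdjoint T) {c : ℂ} (hc : c.im ≠ 0) :
    ∃ R : H →L[ℂ] H, IsShiftInverse A c R ∧ Commute R T := by
  have hc1 : c - 1 ≠ 0 := by
    intro h
    apply hc
    rw [sub_eq_zero.1 h]
    simp
  -- A + c = (1 + (c - 1)T)(A + 1) formally, so the inverse is T (1 + (c - 1)T)⁻¹. The middle factor
  -- is invertible because -(c - 1)⁻¹ is not real while the spectrum of T is.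
  have hunit : IsUnit (1 + (c - 1) • T) := by
    have h1 : -(c - 1)⁻¹ ∉ spectrum ℂ T := by
      intro h
      have h2 := hTsa.im_eq_zero_of_mem_spectrum h
      apply hc
      have : (c - 1) = ((((-(c - 1)⁻¹).re)⁻¹ * -1 : ℝ) : ℂ) := by
        have h3 : -(c - 1)⁻¹ = ((-(c - 1)⁻¹).re : ℂ) := Complex.ext rfl (by rw [h2]; simp)
        push_cast
        rw [← h3]
        field_simp
      have h4 := congrArg Complex.im this
      rw [Complex.ofReal_im] at h4
      simpa using h4
    rw [spectrum.notMem_iff] at h1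
    have h2 : (1 + (c - 1) • T) = (Units.mk0 (-(c - 1)) (neg_ne_zero.2 hc1)) •
        (algebraMap ℂ (H →L[ℂ] H) (-(c - 1)⁻¹) - T) := by
      rw [Algebra.algebraMap_eq_smul_one, Units.smul_mk0, smul_sub, smul_smul, neg_mul_neg,
        mul_inv_cancel₀ hc1, one_smul, neg_smul, sub_neg_eq_add]
    rw [h2]
    exact h1.smul _
  obtain ⟨V, hV⟩ := hunit
  have hVT : Commute (V : H →L[ℂ] H) T := by
    rw [hV]; exact (Commute.one_left T).add_left ((Commute.refl T).smul_left _)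
  have hVT' : Commute ((V⁻¹ : (H →L[ℂ] H)ˣ) : H →L[ℂ] H) T := hVT.units_inv_left
  have hA1 : ∀ y, A ⟨T y, hT.mem_domain y⟩ = y - T y := fun y => by
    have := hT.right_inv y
    rw [one_smul] at this
    exact eq_sub_of_add_eq this
  have hVapp : ∀ y, (V : H →L[ℂ] H) y = y + (c - 1) • T y := fun y => by rw [hV]; simp
  set W : H →L[ℂ] H := ((V⁻¹ : (H →L[ℂ] H)ˣ) : H →L[ℂ] H) with hW
  have hVW : ∀ y, (V : H →L[ℂ] H) (W y) = y := fun y => by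
    rw [← mul_apply_eq_comp, hW, Units.mul_inv, one_apply_eq_self]
  have hWV : ∀ y, W ((V : H →L[ℂ] H) y) = y := fun y => by
    rw [← mul_apply_eq_comp, hW, Units.inv_mul, one_apply_eq_self]
  refine ⟨T * W, ⟨fun y => hT.mem_domain _, fun y => ?_, fun x => ?_⟩,
    (Commute.refl T).mul_left hVT'⟩
  · have h1 := hA1 (W y)
    have h2 := hVW y
    rw [hVapp] at h2
    change A ⟨T (W y), _⟩ + c • T (W y) = y
    rw [h1]
    refine Eq.trans ?_ h2
    module
  · have h1 : T (A x + x) = x := by simpa using hT.left_inv x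
    have h2 : T (A x + c • (x : H)) = (V : H →L[ℂ] H) x := by
      rw [hVapp, show A x + c • (x : H) = (A x + x) + (c - 1) • (x : H) by module, map_add, h1,
        map_smul]
    have h3 : (T * W) (A x + c • (x : H)) = W (T (A x + c • (x : H))) := by
      rw [← hVT'.eq, mul_apply_eq_comp]
    rw [h3, h2, hWV]

end Resolvent

/-! ### Lower bound for the oscillation and conclusion -/

section Main

theorem iOmegaPow_im_pos {α ω : ℝ} (hα₁ : 1 < α) (hα₂ : α < 2) (hω : 0 < ω) :
    0 < (iOmegaPow α ω).im := by
  have hpi := Real.pi_pos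
  rw [iOmegaPow, Complex.im_mul_ofReal, Complex.cpow_def_of_ne_zero Complex.I_ne_zero,
    Complex.log_I, Complex.exp_im]
  have h1 : ((Real.pi : ℂ) / 2 * Complex.I * (α : ℂ)).im = Real.pi / 2 * α := by
    simp
  rw [h1]
  have h2 : 0 < Real.sin (Real.pi / 2 * α) :=
    Real.sin_pos_of_pos_of_lt_pi (by positivity) (by nlinarith)
  have h3 : 0 < ω ^ α := Real.rpow_pos_of_pos hω _
  positivity

theorem tendsto_mlOscillation_sub_exp {α ω : ℝ} (hα₁ : 1 < α) (hα₂ : α < 2) (hω : 0 < ω) :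
    Tendsto (fun t : ℝ => mlOscillation α ω t - 1 / α * Complex.exp (Complex.I * (ω * t : ℝ)))
      atTop (𝓝 0) := by
  refine ((tendsto_fracSeries_I_sub_exp hα₁ hα₂).comp
    (tendsto_id.const_mul_atTop hω)).congr' ?_
  filter_upwards [eventually_ge_atTop 0] with t ht
  simp only [Function.comp_apply, id_eq]
  congr 1
  rw [mlOscillation_eq_fracSeries, fracSeries, fracSeries]
  refine tsum_congr fun k => ?_
  rw [iOmegaPow, Real.mul_rpow hω.le ht, mul_pow, mul_pow, Complex.real_smul, Complex.real_smul]
  push_cast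
  ring

theorem eventually_le_norm_mlOscillation {α ω : ℝ} (hα₁ : 1 < α) (hα₂ : α < 2) (hω : 0 < ω) :
    ∀ᶠ t : ℝ in atTop, 1 / (2 * α) ≤ ‖mlOscillation α ω t‖ := by
  have hα : 0 < 1 / (2 * α) := by positivity
  filter_upwards [Metric.tendsto_nhds.1 (tendsto_mlOscillation_sub_exp hα₁ hα₂ hω) _ hα] with t ht
  rw [dist_zero_right] at ht
  have h1 : ‖(1 / α : ℂ) * Complex.exp (Complex.I * (ω * t : ℝ))‖ = 1 / α := by
    rw [norm_mul, mul_comm Complex.I, Complex.norm_exp_ofReal_mul_I, mul_one, norm_div, norm_one,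
      Complex.norm_real, Real.norm_of_nonneg (by linarith)]
  have h2 := norm_sub_norm_le ((1 / α : ℂ) * Complex.exp (Complex.I * (ω * t : ℝ)))
    (mlOscillation α ω t)
  rw [h1, norm_sub_rev] at h2
  have h3 : 1 / α = 2 * (1 / (2 * α)) := by field_simp
  linarith

end Main

theorem theorem2 {H : Type*} [NormedAddCommGroup H] [InnerProductSpace ℂ H] [CompleteSpace H]
    (A : H →ₗ.[ℂ] H) (hA : IsSelfAdjoint A)
    (hA_nonneg : ∀ x : A.domain, 0 ≤ (inner ℂ (A x) (x : H)).re)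
    (hA_zero : ∀ x : A.domain, A x = 0 → (x : H) = 0)
    (α ω : ℝ) (hα₁ : 1 < α) (hα₂ : α < 2) (hω : 0 < ω)
    (f₀ : H) (hf₀ : f₀ ∈ A.inverse.domain)
    (u : ℝ → H) (hu : IsStrongSolution A α (fun t => mlOscillation α ω t • f₀) u) :
    (∀ᶠ t : ℝ in atTop, mlOscillation α ω t ≠ 0) ∧
      ∃ R : H →L[ℂ] H, IsShiftInverse A (iOmegaPow α ω) R ∧
        Tendsto (fun t : ℝ => (mlOscillation α ω t)⁻¹ • u t) atTop (𝓝 (R f₀)) := by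
  have hα : 0 < 1 / (2 * α) := by positivity
  have hlow := eventually_le_norm_mlOscillation hα₁ hα₂ hω
  have hne : ∀ᶠ t : ℝ in atTop, mlOscillation α ω t ≠ 0 :=
    hlow.mono fun t ht => norm_pos_iff.1 (hα.trans_le ht)
  obtain ⟨T, hT, hTsa, hsp⟩ := exists_resolvent hA hA_nonneg
  obtain ⟨R, hR, hRT⟩ := exists_isShiftInverse_of_im_ne_zero hT hTsa
    (iOmegaPow_im_pos hα₁ hα₂ hω).ne'
  refine ⟨hne, R, hR, ?_⟩
  obtain ⟨g, hg⟩ : ∃ g : A.domain, A g = f₀ := by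
    rw [LinearPMap.inverse_domain] at hf₀
    exact hf₀
  have hTA : ∀ x : A.domain, T (A x + x) = x := fun x => by simpa using hT.left_inv x
  -- The vector y = R(A g + g) works: R commutes with T, so y - T y = R(A g + g - g) = R f₀. This is
  -- where f₀ in the range of A is used.
  have hy : R f₀ = R (A g + g) - T (R (A g + g)) := by
    have h : T (R (A g + g)) = R (T (A g + g)) := by
      rw [← mul_apply_eq_comp, ← hRT.eq, mul_apply_eq_comp]
    rw [h, hTA, ← map_sub, add_sub_cancel_right, hg]
  have hlim := hu.tendsto_sub hα₁ hα₂ (r := ⟨R f₀, hR.mem_domain f₀⟩) (hR.right_inv f₀) hTsa hsp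
    hTA hy
  have hinv : Tendsto (fun t => (mlOscillation α ω t)⁻¹ •
      (mlOscillation α ω t • R f₀ - u t)) atTop (𝓝 0) := by
    have hb := hlim.norm.const_mul (1 / (2 * α))⁻¹
    rw [norm_zero, mul_zero] at hb
    refine squeeze_zero_norm' ?_ hb
    filter_upwards [hlow] with t ht
    rw [norm_smul, norm_inv]
    gcongr
  have hsub := (tendsto_const_nhds (x := R f₀)).sub hinv
  rw [sub_zero] at hsub
  refine hsub.congr' ?_
  filter_upwards [hne] with t ht
  rw [smul_sub, smul_smul, inv_mul_cancel₀ ht, one_smul, sub_sub_cancel]
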